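/- Let $d\in\mathbb N$ and consider $\ell^2(\mathbb Z^2,\mathbb C^d)$. Let $\Theta$ be a fermionic time-reversal map, that is, an anti-unitary operator on this space with $\Theta^2=-\mathbb 1$ that commutes with the two position operators $x_1,x_2$, and let $E_F\in\mathbb R$. Let $H_1,H_2$ be bounded self-adjoint operators on $\ell^2(\mathbb Z^2,\mathbb C^d)$ such that, for $j=1,2$: - $H_j$ is local: for some $\nu>0$, its kernel satisfies $|H_j(x,y)|\le \nu^{-1}e^{-2\nu|x-y|}$ for all $x,y\in\mathbb Z^2$, with $|x-y|$ the Euclidean distance; - $H_j$ is $\Theta$-invariant: $H_j\Theta=\Theta H_j$; - $H_j$ is insulating at energy $E_F$: $E_F\notin\operatorname{Spec}(H_j)$. Let $P_j=\mathbb 1_{(-\infty,E_F)}(H_j)$, $P_j^\perp=\mathbb 1-P_j$, and let $L$ be the operator of multiplication by $x\mapsto e^{i\arg(x_1+ix_2)}$ (with the value $1$ at $x=0$). Then $\ker(P_jLP_j+P_j^\perp)$ is finite-dimensional for $j=1,2$, so that the $\mathbb Z_2$-indices $$\mathcal I(H_j)=\dim\ker\big(P_jLP_j+P_j^\perp\big)\bmod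 2\in\mathbb Z_2$$ are well defined; and there exist $\varepsilon,R>0$ such that, if for some $a\in\mathbb Z^2$ $$\big\|\mathbb 1_{\mathbb B_R(a)}(H_1-H_2)\mathbb 1_{\mathbb B_R(a)}\big\|\le\varepsilon,$$ where $\mathbb B_R(a)\subset\mathbb Z^2$ is the Euclidean ball of radius $R$ centered at $a$ and $\mathbb 1_{S}$ denotes multiplication by the indicator function of $S$, then $\mathcal I(H_1)=\mathcal I(H_2)$. -/

import Mathlib

open scoped InnerProductSpace ComplexConjugate

noncomputable section

namespace Z2Insulator

/-- The lattice `ℤ²`. (The metric that Mathlib puts on the product is never used: lengths of lattice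
vectors are taken after the embedding `toComplex`, so they are Euclidean.) -/
abbrev Lattice : Type := ℤ × ℤ

/-- The lattice point `x = (x₁, x₂)` seen as the complex number `x₁ + i x₂`. -/
def toComplex (x : Lattice) : ℂ := ⟨(x.1 : ℝ), (x.2 : ℝ)⟩

/-- The Euclidean distance `|x - y|` of two lattice points. -/
def eDist (x y : Lattice) : ℝ := ‖toComplex x - toComplex y‖

/-- The fibre `ℂ^d` with its Hermitian inner product. -/
abbrev Fibre (d : ℕ) : Type := EuclideanSpace ℂ (Fin d)

/-- The Hilbert space `ℓ²(ℤ², ℂ^d)`. -/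
abbrev L2 (d : ℕ) : Type := lp (fun _ : Lattice => Fibre d) 2

/-- Bounded operators on `ℓ²(ℤ², ℂ^d)`, with the operator norm. -/
abbrev Op (d : ℕ) : Type := L2 d →L[ℂ] L2 d

theorem memℓp_smul {d : ℕ} (f : Lattice → ℂ) (hf : ∀ x, ‖f x‖ ≤ 1) (ψ : L2 d) :
    Memℓp (fun x => f x • ψ x) 2 := by
  refine (lp.memℓp ψ).mono' (fun x => ?_)
  rw [norm_smul]
  exact mul_le_of_le_one_left (norm_nonneg _) (hf x)

/-- The multiplication operator `(f ψ)(x) = f(x) ψ(x)` by a function with `|f| ≤ 1`. -/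
def mulOp (d : ℕ) (f : Lattice → ℂ) (hf : ∀ x, ‖f x‖ ≤ 1) : Op d :=
  LinearMap.mkContinuous
    { toFun := fun ψ => ⟨fun x => f x • ψ x, memℓp_smul f hf ψ⟩
      map_add' := fun ψ φ => by
        ext1; funext x; exact smul_add (f x) (ψ x) (φ x)
      map_smul' := fun c ψ => by
        ext1; funext x; exact smul_comm (f x) c (ψ x) }
    1 (fun ψ => by
      rw [one_mul]
      refine lp.norm_mono (by norm_num) (fun x => ?_)
      change ‖f x • ψ x‖ ≤ ‖ψ x‖
      rw [norm_smul]
      exact mul_le_of_le_one_left (norm_nonneg _) (hf x))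

theorem mulOp_apply (d : ℕ) (f : Lattice → ℂ) (hf : ∀ x, ‖f x‖ ≤ 1) (ψ : L2 d) (x : Lattice) :
    mulOp d f hf ψ x = f x • ψ x := rfl

/-- The Euclidean ball `𝔹_R(a)` in `ℤ²`. -/
def eBall (a : Lattice) (R : ℝ) : Set Lattice := {x | eDist x a < R}

theorem norm_indicator_le (S : Set Lattice) (x : Lattice) :
    ‖S.indicator (fun _ => (1 : ℂ)) x‖ ≤ 1 := by
  by_cases h : x ∈ S <;> simp [h]

/-- The multiplication operator by the indicator function of `S ⊆ ℤ²`. -/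
def indOp (d : ℕ) (S : Set Lattice) : Op d :=
  mulOp d (S.indicator (fun _ => (1 : ℂ))) (norm_indicator_le S)

/-- The phase `x ↦ exp(i arg(x₁ + i x₂))`. At the origin `arg 0 = 0`, so the phase is `1` there. -/
def laughlinPhase (x : Lattice) : ℂ :=
  Complex.exp (((toComplex x).arg : ℂ) * Complex.I)

theorem norm_laughlinPhase_le (x : Lattice) : ‖laughlinPhase x‖ ≤ 1 :=
  (Complex.norm_exp_ofReal_mul_I _).le

/-- The Laughlin flux insertion operator `L`. -/
def laughlin (d : ℕ) : Op d := mulOp d laughlinPhase norm_laughlinPhase_le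

/-- The kernel `H(x, y)`, an operator on `ℂ^d`: `H(x, y) v = (H (δ_y ⊗ v))(x)`. -/
def kernel {d : ℕ} (H : Op d) (x y : Lattice) : Fibre d →L[ℂ] Fibre d :=
  (lp.evalCLM ℂ (fun _ : Lattice => Fibre d) 2 x).comp
    (H.comp (lp.singleContinuousLinearMap ℂ (fun _ : Lattice => Fibre d) 2 y))

/-- `H` is local: `|H(x, y)| ≤ ν⁻¹ exp(-2 ν |x - y|)` for some `ν > 0`. -/
def IsLocal {d : ℕ} (H : Op d) : Prop :=
  ∃ ν : ℝ, 0 < ν ∧ ∀ x y : Lattice, ‖kernel H x y‖ ≤ ν⁻¹ * Real.exp (-2 * ν * eDist x y)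

/-- `H` is insulating at energy `E`: `E` is not in the spectrum of `H`. -/
def IsInsulating {d : ℕ} (H : Op d) (E : ℝ) : Prop := (E : ℂ) ∉ spectrum ℂ H

/-- `Θ` commutes with the (unbounded, self-adjoint) operator of multiplication by `q : ℤ² → ℝ` on its
maximal domain `{ψ ∈ ℓ² | q ψ ∈ ℓ²}`: if `ψ` is in the domain and `φ = q ψ`, then `Θ ψ` is in the
domain and `q (Θ ψ) = Θ φ`. -/
def CommutesWithMul {d : ℕ} (Θ : L2 d →ₗ⋆[ℂ] L2 d) (q : Lattice → ℝ) : Prop :=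
  ∀ ψ φ : L2 d, (∀ x, φ x = (q x : ℂ) • ψ x) → ∀ x, (Θ φ) x = (q x : ℂ) • (Θ ψ) x

/-- A fermionic time-reversal map: an anti-unitary `Θ` with `Θ² = -1` that commutes with the two
position operators. (Surjectivity follows from `Θ² = -1`.) -/
structure IsTimeReversal {d : ℕ} (Θ : L2 d →ₗ⋆[ℂ] L2 d) : Prop where
  inner_map : ∀ u v : L2 d, ⟪Θ u, Θ v⟫_ℂ = conj ⟪u, v⟫_ℂ
  sq_eq_neg : ∀ u : L2 d, Θ (Θ u) = -u
  comm_pos₁ : CommutesWithMul Θ (fun x => (x.1 : ℝ))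
  comm_pos₂ : CommutesWithMul Θ (fun x => (x.2 : ℝ))

/-- `H` is `Θ`-invariant: `[H, Θ] = 0`. -/
def IsInvariant {d : ℕ} (Θ : L2 d →ₗ⋆[ℂ] L2 d) (H : Op d) : Prop := ∀ ψ : L2 d, H (Θ ψ) = Θ (H ψ)

/-- The bounded self-adjoint, local, `Θ`-invariant Hamiltonians that are insulating at energy `E`. -/
structure IsInsulator {d : ℕ} (Θ : L2 d →ₗ⋆[ℂ] L2 d) (E : ℝ) (H : Op d) : Prop where
  selfAdjoint : IsSelfAdjoint H
  isLocal : IsLocal H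
  invariant : IsInvariant Θ H
  insulating : IsInsulating H E

/-- The spectral projection `P = 1_{(-∞, E)}(H)` of a bounded self-adjoint operator on a Hilbert space,
by functional calculus. It is used only for `E` outside the spectrum of `H`, where the indicator
function is continuous on the spectrum. -/
def spectralProj {K : Type*} [NormedAddCommGroup K] [InnerProductSpace ℂ K] [CompleteSpace K]
    (H : K →L[ℂ] K) (E : ℝ) : K →L[ℂ] K :=
  cfc ((Set.Iio E).indicator (fun _ => (1 : ℝ))) H

/-- The Fermi projection `P` of `H` at energy `E`. -/
def fermiProj {d : ℕ} (H : Op d) (E : ℝ) : Op d := spectralProj H E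

/-- The operator `P L P + P^⊥`. -/
def fluxOp {d : ℕ} (H : Op d) (E : ℝ) : Op d :=
  fermiProj H E * laughlin d * fermiProj H E + (1 - fermiProj H E)

/-- The kernel (null space) of `P L P + P^⊥`. -/
def fluxKer {d : ℕ} (H : Op d) (E : ℝ) : Submodule ℂ (L2 d) :=
  LinearMap.ker (fluxOp H E : L2 d →ₗ[ℂ] L2 d)

/-- The `ℤ₂`-index `dim ker (P L P + P^⊥) mod 2`. -/
def z2Index {d : ℕ} (H : Op d) (E : ℝ) : ZMod 2 := (Module.finrank ℂ (fluxKer H E) : ZMod 2)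

end Z2Insulator

end

/-! Two copies of the Hilbert space are used, with opposite fluxes. Write `P`, `Q` for the Fermi
projections of `H₁`, `H₂`, and consider on `ℓ² × ℓ²` the coupled operator with rows `(P l P + P^⊥, P
χ Q)` and `(-Q χ P, Q l̄ Q + Q^⊥)`, where `χ` is real and `|l|² + χ² = 1`. The uncoupled choice `l =
L`, `χ = 0` has kernel `ker (P L P + P^⊥) × ker (Q L̄ Q + Q^⊥)`, and `Θ` identifies the second
factor antilinearly with `ker (Q L Q + Q^⊥)`. It therefore suffices that the uncoupled kernel be
finite-dimensional of even dimension.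

Analysis. If `P` and `Q` commuted with `l` and `χ`, and `χ P = χ Q`, the coupled operator would be
inverted by the one with `l̄`, `-χ`, because `|l|² + χ² = 1`. Approximate versions of these
relations still give bijectivity (`bijective_coupledFlux`). Near-commutation holds for slowly
varying profiles, since `P` and `Q` are norm limits of polynomials in local operators; `χ P ≈ χ Q`
holds because `χ` is concentrated near `a`, where `H₁` and `H₂` nearly agree (`AgreeLocally`). A
regularized vortex centred at `a` provides `l`. It approaches `L` at infinity, so after a small
correction `l = L` and `χ = 0` off a finite set, and the coupled operator is a finite-rank
perturbation of the uncoupled one.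

Algebra. Since `Θ² = -1`, both operators are skew for the bilinear pairing `⟪Θ p₁, q₁⟫ - ⟪Θ p₂,
q₂⟫`. A skew operator that differs by finite rank from a bijective skew operator has an
even-dimensional kernel (`even_finrank_ker_of_finite_rank_sub`), because alternating forms have even
rank. -/

noncomputable section

namespace Z2Insulator

/-! ### Parity of the kernels of skew operators -/

section LinearAlgebra

variable {V : Type*} [AddCommGroup V] [Module ℂ V]

/-- A finite-dimensional space with a nondegenerate alternating form has even dimension. -/
theorem even_finrank_of_alternating [FiniteDimensional ℂ V] (ω : V →ₗ[ℂ] V →ₗ[ℂ] ℂ)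
    (halt : ∀ v, ω v v = 0) (hker : LinearMap.ker ω = ⊥) : Even (Module.finrank ℂ V) := by
  classical
  by_contra hodd
  rw [Nat.not_even_iff_odd] at hodd
  have hskew : ∀ u v, ω u v = -ω v u := fun u v => by
    have h := halt (u + v)
    simp only [map_add, LinearMap.add_apply, halt] at h
    linear_combination h
  let b := Module.finBasis ℂ V
  let M : Matrix (Fin (Module.finrank ℂ V)) (Fin (Module.finrank ℂ V)) ℂ :=
    Matrix.of fun i j => ω (b i) (b j)
  have hM : M.transpose = -M := by
    ext i j
    exact hskew _ _
  -- A skew matrix of odd size satisfies `det M = -det M`.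
  have hdet : M.det = 0 := by
    have h := congrArg Matrix.det hM
    rw [Matrix.det_transpose, Matrix.det_neg, Fintype.card_fin, hodd.neg_one_pow] at h
    linear_combination h / 2
  obtain ⟨c, hc, hMc⟩ := Matrix.exists_vecMul_eq_zero_iff.2 hdet
  have hv : ω (∑ i, c i • b i) = 0 := by
    refine b.ext fun j => ?_
    have := congrFun hMc j
    simpa [Matrix.vecMul, dotProduct, M] using this
  have h0 : ∑ i, c i • b i = 0 := by
    rw [← LinearMap.mem_ker, hker, Submodule.mem_bot] at hv
    exact hv
  exact hc (funext (Fintype.linearIndependent_iff.1 b.linearIndependent c h0))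

/-- The rank of an alternating form is even. -/
theorem even_finrank_add_finrank_ker [FiniteDimensional ℂ V] (ω : V →ₗ[ℂ] V →ₗ[ℂ] ℂ)
    (halt : ∀ v, ω v v = 0) :
    Even (Module.finrank ℂ V + Module.finrank ℂ (LinearMap.ker ω)) := by
  obtain ⟨W, hW⟩ := (LinearMap.ker ω).exists_isCompl
  have hskew : ∀ u v, ω u v = -ω v u := fun u v => by
    have h := halt (u + v)
    simp only [map_add, LinearMap.add_apply, halt] at h
    linear_combination h
  have hev : Even (Module.finrank ℂ W) := by
    refine even_finrank_of_alternating ((ω.domRestrict₁₂ W W)) (fun v => halt _) ?_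
    rw [LinearMap.ker_eq_bot']
    intro w hw
    have hker : (w : V) ∈ LinearMap.ker ω := by
      rw [LinearMap.mem_ker]
      ext v
      have hv : v ∈ LinearMap.ker ω ⊔ W := hW.sup_eq_top ▸ Submodule.mem_top
      obtain ⟨k, hk, w', hw', rfl⟩ := Submodule.mem_sup.1 hv
      have h1 : ω w k = 0 := by rw [hskew, LinearMap.mem_ker.1 hk]; simp
      have h2 : ω w w' = 0 := LinearMap.congr_fun hw ⟨w', hw'⟩
      simp [h1, h2]
    have := Submodule.disjoint_def.1 hW.disjoint _ hker w.2
    exact Subtype.ext this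
  have := Submodule.finrank_add_eq_of_isCompl hW
  obtain ⟨k, hk⟩ := hev
  exact ⟨k + Module.finrank ℂ (LinearMap.ker ω), by omega⟩

/-- If `S` and `S₀` are skew for a nondegenerate pairing `c`, `S` is bijective, and `S₀ - S` has finite
rank, then the kernel of `S₀` is finite-dimensional, of even dimension. -/
theorem even_finrank_ker_of_finite_rank_sub (c : V →ₗ[ℂ] V →ₗ[ℂ] ℂ)
    (hc : ∀ v, (∀ u, c u v = 0) → v = 0) (S S₀ : V →ₗ[ℂ] V) (hS : Function.Bijective S)
    (halt : ∀ v, c v (S v) = 0) (halt₀ : ∀ v, c v (S₀ v) = 0)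
    (hfin : FiniteDimensional ℂ (LinearMap.range (S₀ - S))) :
    FiniteDimensional ℂ (LinearMap.ker S₀) ∧ Even (Module.finrank ℂ (LinearMap.ker S₀)) := by
  let e : V ≃ₗ[ℂ] V := LinearEquiv.ofBijective S hS
  have he : ∀ v, S (e.symm v) = v := fun v => e.apply_symm_apply v
  -- `S₀ = S (1 + R)` with `R` of finite rank. A kernel vector of `S₀` satisfies `v = R (-v)`, so
  -- everything takes place on the range of `R`; skewness of `S` and `S₀` makes `R` self-adjoint for
  -- the form `c(·, S ·)`.
  let R : V →ₗ[ℂ] V := e.symm.toLinearMap ∘ₗ (S₀ - S)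
  have hSR : ∀ v, S (R v) = S₀ v - S v := fun v => he _
  have skew : ∀ T : V →ₗ[ℂ] V, (∀ v, c v (T v) = 0) → ∀ u v, c u (T v) = -c v (T u) :=
    fun T hT u v => by
      have h := hT (u + v)
      simp only [map_add, LinearMap.add_apply, hT] at h
      linear_combination h
  have hadj : ∀ u v, c (R u) (S v) = c u (S (R v)) := fun u v => by
    rw [skew S halt, hSR, hSR, map_sub, map_sub, skew S halt u v, skew S₀ halt₀ u v]
    ring
  have haltR : ∀ u, c u (S (R u)) = 0 := fun u => by
    rw [hSR, map_sub, halt, halt₀, sub_zero]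
  let W := LinearMap.range R
  have hWfin : FiniteDimensional ℂ W := by
    have : W = (LinearMap.range (S₀ - S)).map e.symm.toLinearMap := LinearMap.range_comp _ _
    rw [this]
    infer_instance
  have hkerW : LinearMap.ker S₀ ≤ W := fun v hv => by
    refine ⟨-v, hS.1 ?_⟩
    rw [hSR]
    simp [LinearMap.mem_ker.1 hv]
  obtain ⟨s, hs⟩ := R.rangeRestrict.exists_rightInverse_of_surjective R.range_rangeRestrict
  have hs' : ∀ w : W, R (s w) = w := fun w =>
    congrArg Subtype.val (LinearMap.congr_fun hs w)
  -- In terms of preimages, `β(Ru, Rv) = c(Ru, Sv) = c(u, SRv)`: independent of the choice of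
  -- section, alternating and nondegenerate, so `W` has even dimension.
  let β : W →ₗ[ℂ] W →ₗ[ℂ] ℂ := (c.compl₁₂ W.subtype (S ∘ₗ s))
  have hβ : ∀ a b : W, β a b = c a (S (s b)) := fun a b => rfl
  let γ : W →ₗ[ℂ] W →ₗ[ℂ] ℂ := (c.compl₁₂ W.subtype (S ∘ₗ W.subtype))
  have hγ : ∀ a b : W, γ a b = c a (S b) := fun a b => rfl
  have hβalt : ∀ a, β a a = 0 := fun a => by
    rw [hβ, ← hs' a, hadj, hs', ← hs' a]
    exact haltR _
  have hβker : LinearMap.ker β = ⊥ := by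
    rw [LinearMap.ker_eq_bot']
    intro a ha
    have h0 : S a = 0 := by
      refine hc _ fun u => ?_
      have h := LinearMap.congr_fun ha ⟨R u, u, rfl⟩
      have hsk : β a ⟨R u, u, rfl⟩ = -β ⟨R u, u, rfl⟩ a := by
        have h := hβalt (a + ⟨R u, u, rfl⟩)
        simp only [map_add, LinearMap.add_apply, hβalt] at h
        linear_combination h
      rw [hsk, hβ] at h
      change -(c (R u) (S (s a))) = 0 at h
      rw [hadj, hs', neg_eq_zero] at h
      exact h
    exact Subtype.ext (hS.1 (by rw [h0]; simp))
  -- `(β + γ)(Ru, a) = c(u, Sa + SRa) = c(u, S₀ a)`, so the radical of the alternating form `β + γ`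
  -- is exactly the kernel of `S₀`.
  have hker : (LinearMap.ker (β + γ)).map W.subtype = LinearMap.ker S₀ := by
    have key : ∀ a : W, a ∈ LinearMap.ker (β + γ) ↔ S₀ a = 0 := by
      intro a
      have h1 : ∀ u, (β + γ) ⟨R u, u, rfl⟩ a = c u (S a + S (R a)) := fun u => by
        rw [LinearMap.add_apply, LinearMap.add_apply, hβ, hγ]
        change c (R u) (S (s a)) + c (R u) (S a) = _
        rw [hadj, hs', hadj, map_add]
      have hsk : ∀ b, (β + γ) a b = -(β + γ) b a := fun b => by
        have hz : ∀ x, (β + γ) x x = 0 := fun x => by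
          rw [LinearMap.add_apply, LinearMap.add_apply, hβalt, hγ, halt, zero_add]
        have h := hz (a + b)
        have ha := hz a
        have hb := hz b
        simp only [map_add, LinearMap.add_apply] at h ha hb ⊢
        linear_combination h - ha - hb
      have h2 : S a + S (R a) = S₀ a := by rw [hSR]; abel
      rw [h2] at h1
      constructor
      · intro ha
        refine hc _ fun u => ?_
        rw [← h1, ← neg_eq_zero, ← hsk, LinearMap.mem_ker.1 ha]
        rfl
      · intro ha
        rw [LinearMap.mem_ker]
        ext ⟨b, u, rfl⟩
        rw [hsk, h1, ha]
        simp
    ext v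
    constructor
    · rintro ⟨a, ha, rfl⟩
      exact LinearMap.mem_ker.2 ((key a).1 ha)
    · intro hv
      exact ⟨⟨v, hkerW hv⟩, (key _).2 (LinearMap.mem_ker.1 hv), rfl⟩
  refine ⟨Submodule.finiteDimensional_of_le hkerW, ?_⟩
  have e1 := even_finrank_of_alternating β hβalt hβker
  have e2 := even_finrank_add_finrank_ker (β + γ) fun a => by
    rw [LinearMap.add_apply, LinearMap.add_apply, hβalt, hγ, halt, zero_add]
  rw [← hker, Submodule.finrank_map_subtype_eq]
  exact (Nat.even_add.1 e2).1 e1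

end LinearAlgebra

/-! ### Invertibility of the coupled flux operator -/

section Block

variable {E : Type*} [NormedAddCommGroup E] [NormedSpace ℂ E]

/-- The operator on `E × E` with the given `2 × 2` matrix of operators. -/
def blockOp (A B C D : E →L[ℂ] E) : E × E →L[ℂ] E × E := (A.coprod B).prod (C.coprod D)

theorem blockOp_apply (A B C D : E →L[ℂ] E) (v : E × E) :
    blockOp A B C D v = (A v.1 + B v.2, C v.1 + D v.2) := rfl

theorem blockOp_mul (A B C D A' B' C' D' : E →L[ℂ] E) :
    blockOp A B C D * blockOp A' B' C' D' =
      blockOp (A * A' + B * C') (A * B' + B * D') (C * A' + D * C') (C * B' + D * D') := by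
  ext v <;> simp [blockOp_apply]

theorem blockOp_sub_one (A B C D : E →L[ℂ] E) :
    blockOp A B C D - 1 = blockOp (A - 1) B C (D - 1) := by
  ext v <;> simp [blockOp_apply]

theorem norm_blockOp_le (A B C D : E →L[ℂ] E) {δ : ℝ} (hA : ‖A‖ ≤ δ) (hB : ‖B‖ ≤ δ)
    (hC : ‖C‖ ≤ δ) (hD : ‖D‖ ≤ δ) : ‖blockOp A B C D‖ ≤ 2 * δ := by
  have hδ : 0 ≤ δ := (norm_nonneg A).trans hA
  have key : ∀ (T U : E →L[ℂ] E), ‖T‖ ≤ δ → ‖U‖ ≤ δ → ∀ v : E × E,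
      ‖T v.1 + U v.2‖ ≤ 2 * δ * ‖v‖ := fun T U hT hU v => by
    refine (norm_add_le _ _).trans ?_
    have h1 := (T.le_of_opNorm_le hT v.1).trans (mul_le_mul_of_nonneg_left (norm_fst_le v) hδ)
    have h2 := (U.le_of_opNorm_le hU v.2).trans (mul_le_mul_of_nonneg_left (norm_snd_le v) hδ)
    linarith
  refine ContinuousLinearMap.opNorm_le_bound _ (by positivity) fun v => ?_
  rw [blockOp_apply, Prod.norm_def]
  exact max_le (key A B hA hB v) (key C D hC hD v)

/-- The flux operators of two projections `P`, `Q` (with opposite fluxes `l`, `m`), coupled by `χ`. -/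
def coupledFlux (P Q l m χ : E →L[ℂ] E) : E × E →L[ℂ] E × E :=
  blockOp (P * l * P + (1 - P)) (P * χ * Q) (-(Q * χ * P)) (Q * m * Q + (1 - Q))

theorem norm_mul_mul_mul_le {A : Type*} [NormedRing A] {a b c d : A} {δ : ℝ} (ha : ‖a‖ ≤ 1)
    (hb : ‖b‖ ≤ 1) (hc : ‖c‖ ≤ δ) (hd : ‖d‖ ≤ 1) : ‖a * b * c * d‖ ≤ δ := by
  have hδ : 0 ≤ δ := (norm_nonneg c).trans hc
  have h1 : ‖a * b‖ ≤ 1 := (norm_mul_le _ _).trans (mul_le_one₀ ha (norm_nonneg _) hb)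
  have h2 : ‖a * b * c‖ ≤ 1 * δ := (norm_mul_le _ _).trans (by gcongr)
  calc ‖a * b * c * d‖ ≤ ‖a * b * c‖ * ‖d‖ := norm_mul_le _ _
    _ ≤ (1 * δ) * 1 := by gcongr
    _ = δ := by ring

-- With exact commutation and `χ P = χ Q`, the diagonal entries of the product reduce to `1` by `m l
-- + χ² = 1` and the off-diagonal ones cancel. In general each entry of the error is a sum of three
-- terms, each with one factor of size `δ` between contractions; the factor `2` comes from the two
-- entries per row in the sup norm on `E × E`.
set_option linter.unusedSimpArgs false in
theorem norm_coupledFlux_mul_sub_one_le {P Q l m χ : E →L[ℂ] E} {δ : ℝ}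
    (hP : P * P = P) (hQ : Q * Q = Q) (hP1 : ‖P‖ ≤ 1) (hQ1 : ‖Q‖ ≤ 1) (hl1 : ‖l‖ ≤ 1)
    (hm1 : ‖m‖ ≤ 1) (hχ1 : ‖χ‖ ≤ 1) (hml : m * l + χ * χ = 1) (hlm : l * m + χ * χ = 1)
    (hlχ : l * χ = χ * l) (hmχ : m * χ = χ * m)
    (hPl : ‖P * l - l * P‖ ≤ δ) (hPχ : ‖P * χ - χ * P‖ ≤ δ)
    (hQm : ‖Q * m - m * Q‖ ≤ δ) (hQχ : ‖Q * χ - χ * Q‖ ≤ δ) (hPQ : ‖χ * (P - Q)‖ ≤ δ) :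
    ‖coupledFlux P Q m l (-χ) * coupledFlux P Q l m χ - 1‖ ≤ 2 * (3 * δ) := by
  have hQP : ‖χ * (Q - P)‖ ≤ δ := by rwa [← neg_sub, mul_neg, norm_neg]
  have three : ∀ {a b c : E →L[ℂ] E}, ‖a‖ ≤ δ → ‖b‖ ≤ δ → ‖c‖ ≤ δ → ‖a + b + c‖ ≤ 3 * δ :=
    fun ha hb hc => (norm_add₃_le).trans (by linarith)
  have neg : ∀ {a : E →L[ℂ] E}, ‖a‖ ≤ δ → ‖-a‖ ≤ δ := fun ha => by rwa [norm_neg]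
  have one : ‖(1 : E →L[ℂ] E)‖ ≤ 1 := ContinuousLinearMap.norm_id_le
  have cP : ∀ x, P * (P * x) = P * x := fun x => by rw [← mul_assoc, hP]
  have cQ : ∀ x, Q * (Q * x) = Q * x := fun x => by rw [← mul_assoc, hQ]
  have eml : m * l = 1 - χ * χ := eq_sub_of_add_eq hml
  have elm : l * m = 1 - χ * χ := eq_sub_of_add_eq hlm
  have cml : ∀ x, m * (l * x) = x - χ * (χ * x) := fun x => by
    rw [← mul_assoc, eml, sub_mul, one_mul, mul_assoc]
  have clm : ∀ x, l * (m * x) = x - χ * (χ * x) := fun x => by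
    rw [← mul_assoc, elm, sub_mul, one_mul, mul_assoc]
  have clχ : ∀ x, l * (χ * x) = χ * (l * x) := fun x => by
    rw [← mul_assoc, hlχ, mul_assoc]
  have cmχ : ∀ x, m * (χ * x) = χ * (m * x) := fun x => by
    rw [← mul_assoc, hmχ, mul_assoc]
  have hχP1 : ‖χ * P‖ ≤ 1 := (norm_mul_le _ _).trans (mul_le_one₀ hχ1 (norm_nonneg _) hP1)
  have hχQ1 : ‖χ * Q‖ ≤ 1 := (norm_mul_le _ _).trans (mul_le_one₀ hχ1 (norm_nonneg _) hQ1)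
  rw [coupledFlux, coupledFlux, blockOp_mul, blockOp_sub_one]
  refine norm_blockOp_le _ _ _ _ ?_ ?_ ?_ ?_
  · convert_to ‖P * m * (P * l - l * P) * P + P * χ * (P * χ - χ * P) * P +
      P * 1 * (χ * (Q - P)) * (χ * P)‖ ≤ _
    · congr 1
      simp only [mul_add, add_mul, mul_sub, sub_mul, mul_assoc, mul_one, one_mul, neg_mul, mul_neg,
        neg_neg, hP, hQ, cP, cQ, cml, clm, clχ, cmχ]
      abel
    · exact three (norm_mul_mul_mul_le hP1 hm1 hPl hP1) (norm_mul_mul_mul_le hP1 hχ1 hPχ hP1)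
        (norm_mul_mul_mul_le hP1 one hQP hχP1)
  · convert_to ‖P * m * (P * χ - χ * P) * Q + P * m * (χ * (P - Q)) * Q +
      -(P * χ * (Q * m - m * Q) * Q)‖ ≤ _
    · congr 1
      simp only [mul_add, add_mul, mul_sub, sub_mul, mul_assoc, mul_one, one_mul, neg_mul, mul_neg,
        neg_neg, hP, hQ, cP, cQ, cml, clm, clχ, cmχ]
      abel
    · exact three (norm_mul_mul_mul_le hP1 hm1 hPχ hQ1) (norm_mul_mul_mul_le hP1 hm1 hPQ hQ1)
        (neg (norm_mul_mul_mul_le hP1 hχ1 hQm hQ1))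
  · convert_to ‖Q * χ * (P * l - l * P) * P + -(Q * l * (Q * χ - χ * Q) * P) +
      -(Q * l * (χ * (Q - P)) * P)‖ ≤ _
    · congr 1
      simp only [mul_add, add_mul, mul_sub, sub_mul, mul_assoc, mul_one, one_mul, neg_mul, mul_neg,
        neg_neg, hP, hQ, cP, cQ, cml, clm, clχ, cmχ]
      abel
    · exact three (norm_mul_mul_mul_le hQ1 hχ1 hPl hP1)
        (neg (norm_mul_mul_mul_le hQ1 hl1 hQχ hP1)) (neg (norm_mul_mul_mul_le hQ1 hl1 hQP hP1))
  · convert_to ‖Q * l * (Q * m - m * Q) * Q + Q * χ * (Q * χ - χ * Q) * Q +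
      Q * 1 * (χ * (P - Q)) * (χ * Q)‖ ≤ _
    · congr 1
      simp only [mul_add, add_mul, mul_sub, sub_mul, mul_assoc, mul_one, one_mul, neg_mul, mul_neg,
        neg_neg, hP, hQ, cP, cQ, cml, clm, clχ, cmχ]
      abel
    · exact three (norm_mul_mul_mul_le hQ1 hl1 hQm hQ1) (norm_mul_mul_mul_le hQ1 hχ1 hQχ hQ1)
        (norm_mul_mul_mul_le hQ1 one hPQ hχQ1)

/-- The coupled flux operator is invertible when the flux and the coupling nearly commute with the
projections, which nearly agree on the support of the coupling. -/
theorem bijective_coupledFlux [CompleteSpace E] {P Q l m χ : E →L[ℂ] E} {δ : ℝ} (hδ : 6 * δ < 1)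
    (hP : P * P = P) (hQ : Q * Q = Q) (hP1 : ‖P‖ ≤ 1) (hQ1 : ‖Q‖ ≤ 1) (hl1 : ‖l‖ ≤ 1)
    (hm1 : ‖m‖ ≤ 1) (hχ1 : ‖χ‖ ≤ 1) (hml : m * l + χ * χ = 1) (hlm : l * m + χ * χ = 1)
    (hlχ : l * χ = χ * l) (hmχ : m * χ = χ * m)
    (hPl : ‖P * l - l * P‖ ≤ δ) (hPm : ‖P * m - m * P‖ ≤ δ) (hPχ : ‖P * χ - χ * P‖ ≤ δ)
    (hQl : ‖Q * l - l * Q‖ ≤ δ) (hQm : ‖Q * m - m * Q‖ ≤ δ) (hQχ : ‖Q * χ - χ * Q‖ ≤ δ)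
    (hPQ : ‖χ * (P - Q)‖ ≤ δ) :
    Function.Bijective (coupledFlux P Q l m χ) := by
  have h1 := norm_coupledFlux_mul_sub_one_le hP hQ hP1 hQ1 hl1 hm1 hχ1 hml hlm hlχ hmχ hPl hPχ
    hQm hQχ hPQ
  -- The product in the other order is the same estimate with `l`, `m` exchanged and `χ` replaced by
  -- `-χ`. The first product gives injectivity, the second surjectivity.
  have h2 := norm_coupledFlux_mul_sub_one_le (χ := -χ) hP hQ hP1 hQ1 hm1 hl1
    (by rwa [norm_neg]) (by rwa [neg_mul_neg]) (by rwa [neg_mul_neg])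
    (by rw [mul_neg, neg_mul, hmχ]) (by rw [mul_neg, neg_mul, hlχ]) hPm
    (by rw [← norm_neg]; simpa [sub_eq_add_neg, add_comm] using hPχ) hQl
    (by rw [← norm_neg]; simpa [sub_eq_add_neg, add_comm] using hQχ)
    (by rwa [neg_mul, norm_neg])
  rw [neg_neg] at h2
  have unit : ∀ T : E × E →L[ℂ] E × E, ‖T - 1‖ ≤ 2 * (3 * δ) → IsUnit T := fun T hT => by
    have h := (Units.oneSub (1 - T) (by rw [norm_sub_rev]; linarith)).isUnit
    rwa [Units.val_oneSub, sub_sub_cancel] at h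
  obtain ⟨u, hu⟩ := unit _ h1
  obtain ⟨w, hw⟩ := unit _ h2
  constructor
  · intro x y hxy
    have h3 : ∀ z, (↑u⁻¹ : E × E →L[ℂ] E × E)
        (coupledFlux P Q m l (-χ) (coupledFlux P Q l m χ z)) = z := fun z => by
      have := congrArg (fun T : E × E →L[ℂ] E × E => T z) u.inv_mul
      rwa [hu] at this
    rw [← h3 x, hxy, h3]
  · intro y
    refine ⟨coupledFlux P Q m l (-χ) ((↑w⁻¹ : E × E →L[ℂ] E × E) y), ?_⟩
    have := congrArg (fun T : E × E →L[ℂ] E × E => T y) w.mul_inv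
    rwa [hw] at this

end Block

/-! ### Multiplication operators and the Schur test -/

section Multiplication

variable {d : ℕ}

theorem norm_mulOp_sub_le {f g : Lattice → ℂ} (hf : ∀ x, ‖f x‖ ≤ 1) (hg : ∀ x, ‖g x‖ ≤ 1) {c : ℝ}
    (hc : 0 ≤ c) (h : ∀ x, ‖f x - g x‖ ≤ c) : ‖mulOp d f hf - mulOp d g hg‖ ≤ c := by
  refine ContinuousLinearMap.opNorm_le_bound _ hc fun ψ => ?_
  refine lp.norm_le_of_forall_sum_le (by norm_num) (by positivity) fun s => ?_
  have h2 : (0 : ℝ) < (2 : ENNReal).toReal := by norm_num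
  calc ∑ x ∈ s, ‖((mulOp d f hf - mulOp d g hg) ψ : L2 d) x‖ ^ (2 : ENNReal).toReal
      ≤ ∑ x ∈ s, (c * ‖ψ x‖) ^ (2 : ENNReal).toReal := by
        refine Finset.sum_le_sum fun x _ => Real.rpow_le_rpow (norm_nonneg _) ?_ h2.le
        change ‖f x • ψ x - g x • ψ x‖ ≤ _
        rw [← sub_smul, norm_smul]
        exact mul_le_mul_of_nonneg_right (h x) (norm_nonneg _)
    _ = c ^ (2 : ENNReal).toReal * ∑ x ∈ s, ‖ψ x‖ ^ (2 : ENNReal).toReal := by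
        rw [Finset.mul_sum]
        exact Finset.sum_congr rfl fun x _ => Real.mul_rpow hc (norm_nonneg _)
    _ ≤ c ^ (2 : ENNReal).toReal * ‖ψ‖ ^ (2 : ENNReal).toReal := by
        gcongr
        exact lp.sum_rpow_le_norm_rpow h2 ψ s
    _ = (c * ‖ψ‖) ^ (2 : ENNReal).toReal := (Real.mul_rpow hc (norm_nonneg _)).symm

theorem norm_mulOp_le {f : Lattice → ℂ} (hf : ∀ x, ‖f x‖ ≤ 1) {c : ℝ}
    (hc : 0 ≤ c) (h : ∀ x, ‖f x‖ ≤ c) : ‖mulOp d f hf‖ ≤ c := by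
  have h0 : mulOp d (fun _ => 0) (by simp) = 0 := by
    ext ψ x i
    simp [mulOp_apply]
  have := norm_mulOp_sub_le (d := d) hf (g := fun _ => 0) (by simp) hc (by simpa using h)
  rwa [h0, sub_zero] at this

theorem norm_mulOp_le_one {f : Lattice → ℂ} (hf : ∀ x, ‖f x‖ ≤ 1) : ‖mulOp d f hf‖ ≤ 1 :=
  norm_mulOp_le hf zero_le_one hf

theorem mulOp_mul_mulOp {f g h : Lattice → ℂ} (hf : ∀ x, ‖f x‖ ≤ 1) (hg : ∀ x, ‖g x‖ ≤ 1)
    (hh : ∀ x, ‖h x‖ ≤ 1) (hfg : ∀ x, f x * g x = h x) :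
    mulOp d f hf * mulOp d g hg = mulOp d h hh := by
  ext1 ψ
  refine lp.ext (funext fun x => ?_)
  change f x • g x • ψ x = h x • ψ x
  rw [smul_smul, hfg]

theorem mulOp_mul_comm {f g : Lattice → ℂ} (hf : ∀ x, ‖f x‖ ≤ 1) (hg : ∀ x, ‖g x‖ ≤ 1) :
    mulOp d f hf * mulOp d g hg = mulOp d g hg * mulOp d f hf := by
  ext1 ψ
  refine lp.ext (funext fun x => ?_)
  exact smul_comm (f x) (g x) (ψ x)

theorem hasSum_kernel_apply (A : Op d) (ψ : L2 d) (x : Lattice) :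
    HasSum (fun y => kernel A x y (ψ y)) (A ψ x) := by
  have h := lp.hasSum_single (p := 2) (by norm_num) ψ
  exact h.mapL ((lp.evalCLM ℂ (fun _ : Lattice => Fibre d) 2 x).comp A)

/-- **Schur test** for operators on `ℓ²(ℤ², ℂ^d)` whose kernel is dominated by a convolution. -/
theorem norm_le_of_kernel_le (A : Op d) {c : Lattice → ℝ} {C : ℝ} (hc : Summable c)
    (hC : ∑' z, c z ≤ C) (hC0 : 0 < C) (hA : ∀ x y, ‖kernel A x y‖ ≤ c (x - y)) : ‖A‖ ≤ C := by
  have h2 : (0 : ℝ) < (2 : ENNReal).toReal := by norm_num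
  have hc0 : ∀ z, 0 ≤ c z := fun z => by
    have := (norm_nonneg _).trans (hA z 0)
    rwa [sub_zero] at this
  refine ContinuousLinearMap.opNorm_le_bound _ hC0.le fun ψ => ?_
  have hψ : ∀ y, ‖ψ y‖ ≤ ‖ψ‖ := fun y => lp.norm_apply_le_norm two_ne_zero ψ y
  have s1 : ∀ x, Summable fun z => c z * ‖ψ (x - z)‖ := fun x =>
    Summable.of_nonneg_of_le (fun z => mul_nonneg (hc0 z) (norm_nonneg _))
      (fun z => mul_le_mul_of_nonneg_left (hψ _) (hc0 z)) (hc.mul_right _)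
  have s2 : ∀ x, Summable fun z => c z * ‖ψ (x - z)‖ ^ 2 := fun x =>
    Summable.of_nonneg_of_le (fun z => mul_nonneg (hc0 z) (sq_nonneg _))
      (fun z => mul_le_mul_of_nonneg_left (pow_le_pow_left₀ (norm_nonneg _) (hψ _) 2) (hc0 z))
      (hc.mul_right _)
  have pointwise : ∀ x, ‖(A ψ : L2 d) x‖ ≤ ∑' z, c z * ‖ψ (x - z)‖ := fun x => by
    have h := (Equiv.subLeft x).hasSum_iff.2 (hasSum_kernel_apply A ψ x)
    rw [← h.tsum_eq]
    refine tsum_of_norm_bounded (s1 x).hasSum fun z => ?_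
    have := (kernel A x (x - z)).le_of_opNorm_le (hA x (x - z)) (ψ (x - z))
    rwa [sub_sub_cancel] at this
  have square : ∀ x, ‖(A ψ : L2 d) x‖ ^ 2 ≤ C * ∑' z, c z * ‖ψ (x - z)‖ ^ 2 := fun x => by
    set a := ‖(A ψ : L2 d) x‖ with ha
    -- Weighted Cauchy–Schwarz, obtained by expanding a nonnegative sum of squares.
    have h0 : 0 ≤ ∑' z, c z * (a - C * ‖ψ (x - z)‖) ^ 2 :=
      tsum_nonneg fun z => mul_nonneg (hc0 z) (sq_nonneg _)
    have h1 : ∑' z, c z * (a - C * ‖ψ (x - z)‖) ^ 2 = a ^ 2 * (∑' z, c z) -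
        2 * a * C * (∑' z, c z * ‖ψ (x - z)‖) + C ^ 2 * ∑' z, c z * ‖ψ (x - z)‖ ^ 2 := by
      rw [← tsum_mul_left, ← tsum_mul_left, ← tsum_mul_left,
        ← (hc.mul_left _).tsum_sub ((s1 x).mul_left _),
        ← ((hc.mul_left _).sub ((s1 x).mul_left _)).tsum_add ((s2 x).mul_left _)]
      exact tsum_congr fun z => by ring
    have ha0 : 0 ≤ a := norm_nonneg _
    have h3 : a ^ 2 * (∑' z, c z) ≤ a ^ 2 * C := mul_le_mul_of_nonneg_left hC (sq_nonneg a)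
    have h4 : 2 * a * C * a ≤ 2 * a * C * ∑' z, c z * ‖ψ (x - z)‖ :=
      mul_le_mul_of_nonneg_left (pointwise x) (by positivity)
    have h5 : C * a ^ 2 ≤ C * (C * ∑' z, c z * ‖ψ (x - z)‖ ^ 2) := by nlinarith
    exact le_of_mul_le_mul_left h5 hC0
  refine lp.norm_le_of_forall_sum_le h2 (by positivity) fun s => ?_
  have hsum : ∀ (φ : L2 d) (t : Finset Lattice), ∑ x ∈ t, ‖φ x‖ ^ 2 ≤ ‖φ‖ ^ 2 := fun φ t => by
    have := lp.sum_rpow_le_norm_rpow h2 φ t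
    simpa using this
  simp only [ENNReal.toReal_ofNat, Real.rpow_ofNat]
  calc ∑ x ∈ s, ‖(A ψ : L2 d) x‖ ^ 2 ≤ ∑ x ∈ s, C * ∑' z, c z * ‖ψ (x - z)‖ ^ 2 :=
        Finset.sum_le_sum fun x _ => square x
    _ = C * ∑' z, c z * ∑ x ∈ s, ‖ψ (x - z)‖ ^ 2 := by
        rw [← Finset.mul_sum, ← Summable.tsum_finsetSum fun x _ => s2 x]
        simp only [Finset.mul_sum]
    _ ≤ C * ∑' z, c z * ‖ψ‖ ^ 2 := by
        have hle : ∀ z, ∑ x ∈ s, ‖ψ (x - z)‖ ^ 2 ≤ ‖ψ‖ ^ 2 := fun z => by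
          have := hsum ψ (s.map (Equiv.subRight z).toEmbedding)
          rwa [Finset.sum_map] at this
        have hle' := fun z => mul_le_mul_of_nonneg_left (hle z) (hc0 z)
        refine mul_le_mul_of_nonneg_left (Summable.tsum_le_tsum hle'
          (Summable.of_nonneg_of_le (fun z => mul_nonneg (hc0 z)
            (Finset.sum_nonneg fun x _ => sq_nonneg _)) hle' (hc.mul_right _))
          (hc.mul_right _)) hC0.le
    _ ≤ C * (C * ‖ψ‖ ^ 2) := by
        rw [tsum_mul_right]
        gcongr
    _ = (C * ‖ψ‖) ^ 2 := by ring

end Multiplication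

/-! ### Near-commutation with slowly varying functions -/

section QuasiLocal

variable {d : ℕ}

theorem summable_int_exp_neg_mul_abs {c : ℝ} (hc : 0 < c) :
    Summable fun n : ℤ => Real.exp (-c * |(n : ℝ)|) := by
  have h : Summable fun n : ℕ => Real.exp (-c * n) := by
    have := summable_geometric_of_lt_one (Real.exp_nonneg (-c)) (Real.exp_lt_one_iff.2 (by linarith))
    refine this.congr fun n => ?_
    rw [← Real.exp_nat_mul, mul_comm]
  refine Summable.of_nat_of_neg (h.congr fun n => ?_) (h.congr fun n => ?_) <;> simp

/-- Half of the decay rate absorbs the linear factor through `t ≤ ν⁻¹ exp(ν t)`; the other half is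
dominated by a product of two one-dimensional geometric series. -/
theorem summable_norm_mul_exp {ν : ℝ} (hν : 0 < ν) :
    Summable fun z : Lattice => ‖toComplex z‖ * Real.exp (-2 * ν * ‖toComplex z‖) := by
  have hs := (summable_int_exp_neg_mul_abs (half_pos hν)).mul_of_nonneg
    (summable_int_exp_neg_mul_abs (half_pos hν)) (fun _ => Real.exp_nonneg _)
    (fun _ => Real.exp_nonneg _)
  refine Summable.of_nonneg_of_le (fun z => by positivity) (fun z => ?_) (hs.mul_left ν⁻¹)
  set t := ‖toComplex z‖
  have h1 : |(z.1 : ℝ)| ≤ t := Complex.abs_re_le_norm (toComplex z)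
  have h2 : |(z.2 : ℝ)| ≤ t := Complex.abs_im_le_norm (toComplex z)
  have h3 : t ≤ ν⁻¹ * Real.exp (ν * t) := by
    rw [inv_mul_eq_div, le_div_iff₀ hν]
    linarith [Real.add_one_le_exp (ν * t)]
  calc t * Real.exp (-2 * ν * t) ≤ ν⁻¹ * Real.exp (ν * t) * Real.exp (-2 * ν * t) := by gcongr
    _ = ν⁻¹ * Real.exp (-(ν * t)) := by
        rw [mul_assoc, ← Real.exp_add]
        ring_nf
    _ ≤ ν⁻¹ * Real.exp (-(ν / 2) * |(z.1 : ℝ)| + -(ν / 2) * |(z.2 : ℝ)|) := by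
        gcongr
        nlinarith
    _ = _ := by rw [Real.exp_add]

theorem toComplex_sub (x y : Lattice) : toComplex (x - y) = toComplex x - toComplex y := by
  apply Complex.ext <;> simp [toComplex]

/-- `A` nearly commutes with slowly varying functions. -/
def IsQuasiLocal (A : Op d) : Prop :=
  ∀ δ : ℝ, 0 < δ → ∃ κ : ℝ, 0 < κ ∧ ∀ (f : Lattice → ℂ) (hf : ∀ x, ‖f x‖ ≤ 1),
    (∀ x y, ‖f x - f y‖ ≤ κ * eDist x y) → ‖A * mulOp d f hf - mulOp d f hf * A‖ ≤ δ

/-- The commutator with `f` has kernel `(f(y) - f(x)) A(x, y)`. The Lipschitz bound contributes `κ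
|x - y|`, which the exponential decay makes summable, and the Schur test applies. -/
theorem IsLocal.isQuasiLocal {A : Op d} (hA : IsLocal A) : IsQuasiLocal A := by
  obtain ⟨ν, hν, hA⟩ := hA
  intro δ hδ
  have hs := summable_norm_mul_exp hν
  set S := ∑' z : Lattice, ‖toComplex z‖ * Real.exp (-2 * ν * ‖toComplex z‖) with hS
  have hS0 : 0 ≤ S := tsum_nonneg fun z => by positivity
  refine ⟨δ * ν / (S + 1), by positivity, fun f hf hLip => ?_⟩
  set κ := δ * ν / (S + 1) with hκ
  have hκ0 : 0 < κ := by positivity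
  refine norm_le_of_kernel_le _ (hs.mul_left (κ * ν⁻¹)) ?_ hδ fun x y => ?_
  · rw [tsum_mul_left, ← hS, hκ]
    have : δ * ν / (S + 1) * ν⁻¹ * S = δ * (S / (S + 1)) := by field_simp
    rw [this]
    exact mul_le_of_le_one_right hδ.le ((div_le_one (by positivity)).2 (by linarith))
  · have hker : kernel (A * mulOp d f hf - mulOp d f hf * A) x y = (f y - f x) • kernel A x y := by
      ext1 v
      have h1 : mulOp d f hf (lp.single 2 y v) = f y • lp.single 2 y v := by
        refine lp.ext (funext fun z => ?_)
        rw [mulOp_apply, lp.coeFn_smul, Pi.smul_apply]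
        rcases eq_or_ne z y with rfl | hzy
        · rfl
        · rw [lp.single_apply_ne _ _ _ hzy, smul_zero, smul_zero]
      change A (mulOp d f hf (lp.single 2 y v)) x - f x • A (lp.single 2 y v) x =
        (f y - f x) • A (lp.single 2 y v) x
      rw [h1, map_smul, sub_smul]
      rfl
    rw [hker, norm_smul, norm_sub_rev, toComplex_sub]
    calc ‖f x - f y‖ * ‖kernel A x y‖
        ≤ (κ * eDist x y) * (ν⁻¹ * Real.exp (-2 * ν * eDist x y)) :=
          mul_le_mul (hLip x y) (hA x y) (norm_nonneg _)
            (mul_nonneg hκ0.le (norm_nonneg _))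
      _ = _ := by rw [eDist]; ring

theorem isQuasiLocal_smul_one (c : ℝ) : IsQuasiLocal (c • (1 : Op d)) := fun δ hδ =>
  ⟨1, one_pos, fun f hf _ => by simpa using hδ.le⟩

theorem IsQuasiLocal.exists_common {A B : Op d} (hA : IsQuasiLocal A) (hB : IsQuasiLocal B)
    {δ : ℝ} (hδ : 0 < δ) : ∃ κ : ℝ, 0 < κ ∧ ∀ (f : Lattice → ℂ) (hf : ∀ x, ‖f x‖ ≤ 1),
      (∀ x y, ‖f x - f y‖ ≤ κ * eDist x y) →
        ‖A * mulOp d f hf - mulOp d f hf * A‖ ≤ δ ∧ ‖B * mulOp d f hf - mulOp d f hf * B‖ ≤ δ := by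
  obtain ⟨κ, hκ, h⟩ := hA δ hδ
  obtain ⟨κ', hκ', h'⟩ := hB δ hδ
  refine ⟨min κ κ', lt_min hκ hκ', fun f hf hLip => ⟨h f hf fun x y => (hLip x y).trans ?_,
    h' f hf fun x y => (hLip x y).trans ?_⟩⟩
  · exact mul_le_mul_of_nonneg_right (min_le_left _ _) (norm_nonneg _)
  · exact mul_le_mul_of_nonneg_right (min_le_right _ _) (norm_nonneg _)

theorem IsQuasiLocal.add {A B : Op d} (hA : IsQuasiLocal A) (hB : IsQuasiLocal B) :
    IsQuasiLocal (A + B) := fun δ hδ => by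
  obtain ⟨κ, hκ, h⟩ := hA.exists_common hB (half_pos hδ)
  refine ⟨κ, hκ, fun f hf hLip => ?_⟩
  obtain ⟨h1, h2⟩ := h f hf hLip
  have : (A + B) * mulOp d f hf - mulOp d f hf * (A + B) =
      (A * mulOp d f hf - mulOp d f hf * A) + (B * mulOp d f hf - mulOp d f hf * B) := by
    noncomm_ring
  rw [this]
  exact (norm_add_le _ _).trans (by linarith)

theorem IsQuasiLocal.mul {A B : Op d} (hA : IsQuasiLocal A) (hB : IsQuasiLocal B) :
    IsQuasiLocal (A * B) := fun δ hδ => by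
  have hpos : 0 < ‖A‖ + ‖B‖ + 1 := by positivity
  obtain ⟨κ, hκ, h⟩ := hA.exists_common hB (div_pos hδ hpos)
  refine ⟨κ, hκ, fun f hf hLip => ?_⟩
  obtain ⟨h1, h2⟩ := h f hf hLip
  have : (A * B) * mulOp d f hf - mulOp d f hf * (A * B) =
      A * (B * mulOp d f hf - mulOp d f hf * B) + (A * mulOp d f hf - mulOp d f hf * A) * B := by
    noncomm_ring
  rw [this]
  set t := δ / (‖A‖ + ‖B‖ + 1) with ht
  have ht0 : 0 < t := div_pos hδ hpos
  have ht' : t * (‖A‖ + ‖B‖ + 1) = δ := div_mul_cancel₀ _ hpos.ne'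
  have e1 : ‖A * (B * mulOp d f hf - mulOp d f hf * B)‖ ≤ ‖A‖ * t :=
    (norm_mul_le _ _).trans (by gcongr)
  have e2 : ‖(A * mulOp d f hf - mulOp d f hf * A) * B‖ ≤ t * ‖B‖ :=
    (norm_mul_le _ _).trans (by gcongr)
  exact (norm_add_le _ _).trans (by nlinarith)

theorem norm_commutator_sub_le {A : Type*} [NormedRing A] {a b m : A} {δ : ℝ} (h : ‖a - b‖ ≤ δ)
    (hm : ‖m‖ ≤ 1) : ‖a * m - m * a‖ ≤ ‖b * m - m * b‖ + 2 * δ := by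
  have : a * m - m * a = (b * m - m * b) + ((a - b) * m - m * (a - b)) := by noncomm_ring
  rw [this]
  have hδ := (norm_nonneg _).trans h
  have e1 : ‖(a - b) * m‖ ≤ δ * 1 := (norm_mul_le _ _).trans (by gcongr)
  have e2 : ‖m * (a - b)‖ ≤ 1 * δ := (norm_mul_le _ _).trans (by gcongr)
  exact (norm_add_le _ _).trans (by linarith [norm_sub_le ((a - b) * m) (m * (a - b))])

theorem isQuasiLocal_of_approx {A : Op d}
    (h : ∀ δ : ℝ, 0 < δ → ∃ B : Op d, IsQuasiLocal B ∧ ‖A - B‖ ≤ δ) : IsQuasiLocal A :=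
  fun δ hδ => by
  obtain ⟨B, hB, hAB⟩ := h (δ / 4) (by linarith)
  obtain ⟨κ, hκ, hκ'⟩ := hB (δ / 2) (by linarith)
  refine ⟨κ, hκ, fun f hf hLip => ?_⟩
  exact (norm_commutator_sub_le hAB (norm_mulOp_le_one hf)).trans (by linarith [hκ' f hf hLip])

end QuasiLocal

/-! ### Local agreement of operators -/

section AgreeLocally

variable {d : ℕ}

theorem norm_indOp_le_one (S : Set Lattice) : ‖indOp d S‖ ≤ 1 := norm_mulOp_le_one _

theorem indOp_mul_indOp {S T : Set Lattice} (h : S ⊆ T) : indOp d S * indOp d T = indOp d S :=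
  mulOp_mul_mulOp _ _ _ fun x => by
    by_cases hx : x ∈ S
    · simp [hx, h hx]
    · simp [hx]

theorem indOp_mul_indOp' {S T : Set Lattice} (h : S ⊆ T) : indOp d T * indOp d S = indOp d S := by
  rw [indOp, indOp, mulOp_mul_comm]
  exact indOp_mul_indOp h

theorem eBall_subset {a : Lattice} {r R : ℝ} (h : r ≤ R) : eBall a r ⊆ eBall a R :=
  fun _ hx => lt_of_lt_of_le hx h

theorem norm_cutoff_le_of_le {X : Op d} {a : Lattice} {r R : ℝ} (h : r ≤ R) :
    ‖indOp d (eBall a r) * X * indOp d (eBall a r)‖ ≤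
      ‖indOp d (eBall a R) * X * indOp d (eBall a R)‖ := by
  have : indOp d (eBall a r) * X * indOp d (eBall a r) =
      indOp d (eBall a r) * (indOp d (eBall a R) * X * indOp d (eBall a R)) *
        indOp d (eBall a r) := by
    calc _ = indOp d (eBall a r) * indOp d (eBall a R) * X *
          (indOp d (eBall a R) * indOp d (eBall a r)) := by
          rw [indOp_mul_indOp (eBall_subset h), indOp_mul_indOp' (eBall_subset h)]
      _ = _ := by simp only [mul_assoc]
  rw [this]
  refine (norm_mul_le _ _).trans ((mul_le_of_le_one_right (norm_nonneg _)
    (norm_indOp_le_one _)).trans ((norm_mul_le _ _).trans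
      (mul_le_of_le_one_left (norm_nonneg _) (norm_indOp_le_one _))))

theorem abs_eDist_sub_le (x y a : Lattice) : |eDist x a - eDist y a| ≤ eDist x y := by
  have := abs_norm_sub_norm_le (toComplex x - toComplex a) (toComplex y - toComplex a)
  rwa [sub_sub_sub_cancel_right] at this

/-- Interpose a radial `κ`-Lipschitz cutoff equal to `1` on the small ball and `0` off the ball of
radius `r + κ⁻¹`: only its commutator with `A` survives between the two indicators. -/
theorem IsQuasiLocal.exists_norm_tail_le {A : Op d} (hA : IsQuasiLocal A) {δ : ℝ} (hδ : 0 < δ)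
    (r : ℝ) : ∃ R : ℝ, r ≤ R ∧ ∀ a, ‖indOp d (eBall a r) * A * (1 - indOp d (eBall a R))‖ ≤ δ := by
  obtain ⟨κ, hκ, h⟩ := hA (δ / 2) (half_pos hδ)
  refine ⟨r + κ⁻¹, by linarith [inv_pos.2 hκ], fun a => ?_⟩
  let g : Lattice → ℝ := fun x => max 0 (min 1 (1 + κ * r - κ * eDist x a))
  let f : Lattice → ℂ := fun x => (g x : ℂ)
  have hf : ∀ x, ‖f x‖ ≤ 1 := fun x => by
    have h0 : 0 ≤ g x := le_max_left _ _
    have h1 : g x ≤ 1 := max_le zero_le_one (min_le_left _ _)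
    simpa [f, abs_of_nonneg h0] using h1
  have hLip : ∀ x y, ‖f x - f y‖ ≤ κ * eDist x y := fun x y => by
    rw [← Complex.ofReal_sub, Complex.norm_real, Real.norm_eq_abs]
    refine (abs_max_sub_max_le_max _ _ _ _).trans (max_le ?_ ((abs_min_sub_min_le_max _ _ _ _).trans
      (max_le ?_ ?_)))
    · simpa [eDist] using mul_nonneg hκ.le (norm_nonneg _)
    · simpa [eDist] using mul_nonneg hκ.le (norm_nonneg _)
    · have : 1 + κ * r - κ * eDist x a - (1 + κ * r - κ * eDist y a) =
          -(κ * (eDist x a - eDist y a)) := by ring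
      rw [this, abs_neg, abs_mul, abs_of_pos hκ]
      exact mul_le_mul_of_nonneg_left (abs_eDist_sub_le x y a) hκ.le
  have e1 : indOp d (eBall a r) * mulOp d f hf = indOp d (eBall a r) :=
    mulOp_mul_mulOp _ _ _ fun x => by
      by_cases hx : x ∈ eBall a r
      · have hx' : eDist x a < r := hx
        have : g x = 1 := by
          have : (1 : ℝ) ≤ 1 + κ * r - κ * eDist x a := by nlinarith
          simp [g, min_eq_left this]
        simp [f, this]
      · simp [hx]
  have e2 : mulOp d f hf * indOp d (eBall a (r + κ⁻¹)) = mulOp d f hf :=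
    mulOp_mul_mulOp _ _ _ fun x => by
      by_cases hx : x ∈ eBall a (r + κ⁻¹)
      · simp [hx]
      · have hx' : r + κ⁻¹ ≤ eDist x a := not_lt.1 hx
        have : g x = 0 := by
          have h1 : κ * (r + κ⁻¹) ≤ κ * eDist x a := mul_le_mul_of_nonneg_left hx' hκ.le
          rw [mul_add, mul_inv_cancel₀ hκ.ne'] at h1
          exact max_eq_left ((min_le_right _ _).trans (by linarith))
        simp [f, this]
  set I := indOp d (eBall a r)
  set J := indOp d (eBall a (r + κ⁻¹))
  set M := mulOp d f hf
  have : I * A * (1 - J) = -(I * (A * M - M * A) * (1 - J)) := by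
    have e3 : A * M * (1 - J) = 0 := by rw [mul_assoc, mul_sub, mul_one, e2, sub_self, mul_zero]
    have e4 : I * (A * M - M * A) * (1 - J) = I * (A * M * (1 - J)) - I * M * A * (1 - J) := by
      noncomm_ring
    rw [e4, e3, e1, mul_zero, zero_sub, neg_neg]
  rw [this, norm_neg]
  have hJ : ‖1 - J‖ ≤ 2 := (norm_sub_le _ _).trans (by
    have h1 : ‖(1 : Op d)‖ ≤ 1 := ContinuousLinearMap.norm_id_le
    linarith [norm_indOp_le_one (d := d) (eBall a (r + κ⁻¹))])
  calc ‖I * (A * M - M * A) * (1 - J)‖ ≤ ‖I * (A * M - M * A)‖ * ‖1 - J‖ := norm_mul_le _ _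
    _ ≤ (1 * (δ / 2)) * 2 := by
        gcongr
        exact (norm_mul_le _ _).trans (mul_le_mul (norm_indOp_le_one _) (h f hf hLip)
          (norm_nonneg _) zero_le_one)
    _ = δ := by ring

/-- `A₁` and `A₂` nearly agree on every ball on a large neighbourhood of which `H₁` and `H₂` nearly
agree, uniformly in the centre. -/
def AgreeLocally (H₁ H₂ A₁ A₂ : Op d) : Prop :=
  ∀ δ r : ℝ, 0 < δ → ∃ ε R : ℝ, 0 < ε ∧ 0 < R ∧ ∀ a,
    ‖indOp d (eBall a R) * (H₁ - H₂) * indOp d (eBall a R)‖ ≤ ε →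
      ‖indOp d (eBall a r) * (A₁ - A₂)‖ ≤ δ

variable {H₁ H₂ A₁ A₂ B₁ B₂ : Op d}

theorem AgreeLocally.exists_common (hA : AgreeLocally H₁ H₂ A₁ A₂)
    (hB : AgreeLocally H₁ H₂ B₁ B₂) {δ : ℝ} (hδ : 0 < δ) (r s : ℝ) :
    ∃ ε R : ℝ, 0 < ε ∧ 0 < R ∧ ∀ a,
      ‖indOp d (eBall a R) * (H₁ - H₂) * indOp d (eBall a R)‖ ≤ ε →
        ‖indOp d (eBall a r) * (A₁ - A₂)‖ ≤ δ ∧ ‖indOp d (eBall a s) * (B₁ - B₂)‖ ≤ δ := by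
  obtain ⟨ε, R, hε, hR, h⟩ := hA δ r hδ
  obtain ⟨ε', R', hε', hR', h'⟩ := hB δ s hδ
  refine ⟨min ε ε', max R R', lt_min hε hε', lt_max_of_lt_left hR, fun a ha => ⟨h a ?_, h' a ?_⟩⟩
  · exact (norm_cutoff_le_of_le (le_max_left _ _)).trans (ha.trans (min_le_left _ _))
  · exact (norm_cutoff_le_of_le (le_max_right _ _)).trans (ha.trans (min_le_right _ _))

theorem agreeLocally_self (A : Op d) : AgreeLocally H₁ H₂ A A := fun δ r hδ =>
  ⟨1, 1, one_pos, one_pos, fun a _ => by simpa using hδ.le⟩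

theorem AgreeLocally.add (hA : AgreeLocally H₁ H₂ A₁ A₂) (hB : AgreeLocally H₁ H₂ B₁ B₂) :
    AgreeLocally H₁ H₂ (A₁ + B₁) (A₂ + B₂) := fun δ r hδ => by
  obtain ⟨ε, R, hε, hR, h⟩ := hA.exists_common hB (half_pos hδ) r r
  refine ⟨ε, R, hε, hR, fun a ha => ?_⟩
  obtain ⟨h1, h2⟩ := h a ha
  have : A₁ + B₁ - (A₂ + B₂) = (A₁ - A₂) + (B₁ - B₂) := by abel
  rw [this, mul_add]
  exact (norm_add_le _ _).trans (by linarith)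

/-- In `A₂ (B₁ - B₂)` the cutoff stands to the left of `A₂`. The tail estimate for `A₂` moves it to
the right, at the price of a larger ball. -/
theorem AgreeLocally.mul (hA : AgreeLocally H₁ H₂ A₁ A₂) (hB : AgreeLocally H₁ H₂ B₁ B₂)
    (hA₂ : IsQuasiLocal A₂) : AgreeLocally H₁ H₂ (A₁ * B₁) (A₂ * B₂) := fun δ r hδ => by
  set K := ‖B₁‖ + ‖A₂‖ + ‖B₁ - B₂‖ + 1 with hK
  have hK0 : 0 < K := by positivity
  have hδK : 0 < δ / K := div_pos hδ hK0
  obtain ⟨s, -, hs⟩ := hA₂.exists_norm_tail_le hδK r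
  obtain ⟨ε, R, hε, hR, h⟩ := hA.exists_common hB hδK r s
  refine ⟨ε, R, hε, hR, fun a ha => ?_⟩
  obtain ⟨h1, h2⟩ := h a ha
  have hsa := hs a
  set I := indOp d (eBall a r)
  set J := indOp d (eBall a s)
  have : I * (A₁ * B₁ - A₂ * B₂) = I * (A₁ - A₂) * B₁ + (I * A₂ * (J * (B₁ - B₂)) +
      I * A₂ * (1 - J) * (B₁ - B₂)) := by noncomm_ring
  rw [this]
  set t := δ / K with ht
  have ht' : t * K = δ := div_mul_cancel₀ _ hK0.ne'
  have hI : ‖I * A₂‖ ≤ 1 * ‖A₂‖ := (norm_mul_le _ _).trans (by gcongr; exact norm_indOp_le_one _)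
  have e1 : ‖I * (A₁ - A₂) * B₁‖ ≤ t * ‖B₁‖ := (norm_mul_le _ _).trans (by gcongr)
  have e2 : ‖I * A₂ * (J * (B₁ - B₂))‖ ≤ 1 * ‖A₂‖ * t := (norm_mul_le _ _).trans (by gcongr)
  have e3 : ‖I * A₂ * (1 - J) * (B₁ - B₂)‖ ≤ t * ‖B₁ - B₂‖ :=
    (norm_mul_le _ _).trans (by gcongr)
  refine (norm_add_le _ _).trans ?_
  have := norm_add_le (I * A₂ * (J * (B₁ - B₂))) (I * A₂ * (1 - J) * (B₁ - B₂))
  rw [hK] at ht'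
  nlinarith

/-- The hypothesis cuts off on both sides, the conclusion only on the left; the missing right cutoff
is a tail of the quasi-local operator `H₁ - H₂`. -/
theorem agreeLocally_of_isQuasiLocal (h₁ : IsQuasiLocal H₁) (h₂ : IsQuasiLocal H₂) :
    AgreeLocally H₁ H₂ H₁ H₂ := fun δ r hδ => by
  have hq : IsQuasiLocal (H₁ - H₂) := by
    have := h₁.add ((isQuasiLocal_smul_one (-1)).mul h₂)
    simpa [sub_eq_add_neg] using this
  obtain ⟨s, hrs, hs⟩ := hq.exists_norm_tail_le (half_pos hδ) r
  refine ⟨δ / 2, max s 1, half_pos hδ, lt_max_of_lt_right one_pos, fun a ha => ?_⟩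
  have h1 := (norm_cutoff_le_of_le (le_max_left s 1)).trans ha
  have h2 := hs a
  have hIJ := indOp_mul_indOp (d := d) (eBall_subset (a := a) hrs)
  set I := indOp d (eBall a r)
  set J := indOp d (eBall a s)
  have : I * (H₁ - H₂) = I * (J * (H₁ - H₂) * J) + I * (H₁ - H₂) * (1 - J) := by
    have : I * (J * (H₁ - H₂) * J) = (I * J) * (H₁ - H₂) * J := by noncomm_ring
    rw [this, hIJ]
    noncomm_ring
  rw [this]
  refine (norm_add_le _ _).trans ?_
  have e1 : ‖I * (J * (H₁ - H₂) * J)‖ ≤ 1 * (δ / 2) :=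
    (norm_mul_le _ _).trans (by gcongr; exact norm_indOp_le_one _)
  linarith

theorem agreeLocally_of_approx
    (h : ∀ δ : ℝ, 0 < δ → ∃ B₁ B₂ : Op d, AgreeLocally H₁ H₂ B₁ B₂ ∧ ‖A₁ - B₁‖ ≤ δ ∧
      ‖A₂ - B₂‖ ≤ δ) : AgreeLocally H₁ H₂ A₁ A₂ := fun δ r hδ => by
  obtain ⟨B₁, B₂, hB, h1, h2⟩ := h (δ / 4) (by linarith)
  obtain ⟨ε, R, hε, hR, hε'⟩ := hB (δ / 2) r (half_pos hδ)
  refine ⟨ε, R, hε, hR, fun a ha => ?_⟩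
  have h3 := hε' a ha
  set I := indOp d (eBall a r)
  have : I * (A₁ - A₂) = I * (B₁ - B₂) + I * ((A₁ - B₁) - (A₂ - B₂)) := by noncomm_ring
  rw [this]
  have e : ‖I * ((A₁ - B₁) - (A₂ - B₂))‖ ≤ 1 * (δ / 4 + δ / 4) := by
    refine (norm_mul_le _ _).trans (mul_le_mul (norm_indOp_le_one _) ?_ (norm_nonneg _)
      zero_le_one)
    exact (norm_sub_le _ _).trans (by linarith)
  exact (norm_add_le _ _).trans (by linarith)

end AgreeLocally

/-! ### Polynomial approximation of the Fermi projections -/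

section FermiProjection

theorem spectrum_gap {A : Type*} [NormedRing A] [NormedAlgebra ℝ A] [NormedAlgebra ℂ A]
    [IsScalarTower ℝ ℂ A] [CompleteSpace A] {H : A} {E : ℝ} (hE : (E : ℂ) ∉ spectrum ℂ H) :
    ∃ g : ℝ, 0 < g ∧ ∀ t ∈ spectrum ℝ H, g ≤ |t - E| := by
  have hE' : E ∉ spectrum ℝ H := fun h => hE ((spectrum.algebraMap_mem_iff ℂ).2 h)
  obtain ⟨g, hg, hball⟩ := Metric.isOpen_iff.1 (spectrum.isClosed (𝕜 := ℝ) H).isOpen_compl E hE'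
  exact ⟨g, hg, fun t ht => not_lt.1 fun hlt => hball (Metric.mem_ball.2 hlt) ht⟩

variable {K : Type*} [NormedAddCommGroup K] [InnerProductSpace ℂ K]

theorem continuousOn_indicator_spectrum {H : K →L[ℂ] K} {E : ℝ} (hE : (E : ℂ) ∉ spectrum ℂ H) :
    ContinuousOn ((Set.Iio E).indicator (fun _ => (1 : ℝ))) (spectrum ℝ H) := by
  have hE' : E ∉ spectrum ℝ H := fun h => hE ((spectrum.algebraMap_mem_iff ℂ).2 h)
  refine ContinuousOn.mono (s := {E}ᶜ) (fun t ht => ContinuousAt.continuousWithinAt ?_)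
    fun t ht h => hE' (h ▸ ht)
  rcases lt_or_gt_of_ne (show t ≠ E from ht) with h | h
  · exact (continuousAt_const (y := (1 : ℝ))).congr (Filter.eventually_of_mem (Iio_mem_nhds h)
      fun s hs => by rw [Set.indicator_of_mem hs])
  · exact (continuousAt_const (y := (0 : ℝ))).congr (Filter.eventually_of_mem (Ioi_mem_nhds h)
      fun s hs => by 
        have h' : ¬ s < E := not_lt.2 (le_of_lt hs)
        simp [h'])

variable [CompleteSpace K]

theorem spectralProj_mul_self {H : K →L[ℂ] K} {E : ℝ} (hE : (E : ℂ) ∉ spectrum ℂ H) :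
    spectralProj H E * spectralProj H E = spectralProj H E := by
  have hc := continuousOn_indicator_spectrum hE
  rw [spectralProj, ← cfc_mul _ _ H hc hc]
  refine cfc_congr fun t _ => ?_
  by_cases h : t ∈ Set.Iio E <;> simp [h]

theorem isSelfAdjoint_spectralProj (H : K →L[ℂ] K) (E : ℝ) : IsSelfAdjoint (spectralProj H E) :=
  cfc_predicate _ _

theorem norm_spectralProj_le (H : K →L[ℂ] K) (E : ℝ) : ‖spectralProj H E‖ ≤ 1 :=
  norm_cfc_le zero_le_one fun t _ => by
    by_cases h : t ∈ Set.Iio E <;> simp [h]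

/-- One polynomial serves both operators, so that local agreement of `H₁` and `H₂` passes to the
approximants. -/
theorem exists_polynomial_near_spectralProj {H₁ H₂ : K →L[ℂ] K} {E : ℝ} (s₁ : IsSelfAdjoint H₁)
    (s₂ : IsSelfAdjoint H₂) (h₁ : (E : ℂ) ∉ spectrum ℂ H₁) (h₂ : (E : ℂ) ∉ spectrum ℂ H₂) {δ : ℝ}
    (hδ : 0 < δ) : ∃ q : Polynomial ℝ, ‖spectralProj H₁ E - Polynomial.aeval H₁ q‖ ≤ δ ∧
      ‖spectralProj H₂ E - Polynomial.aeval H₂ q‖ ≤ δ := by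
  obtain ⟨g₁, hg₁, hgap₁⟩ := spectrum_gap h₁
  obtain ⟨g₂, hg₂, hgap₂⟩ := spectrum_gap h₂
  set g := min g₁ g₂
  have hg : 0 < g := lt_min hg₁ hg₂
  set M := max ‖H₁‖ ‖H₂‖
  -- No spectrum lies within `g` of `E`, so this continuous ramp coincides with the indicator on
  -- both spectra, which are contained in `[-M, M]`.
  obtain ⟨q, hq⟩ := exists_polynomial_near_of_continuousOn (-M) M
    (fun t => max 0 (min 1 ((E - t) / g))) (by fun_prop) δ hδ
  have key : ∀ H : K →L[ℂ] K, IsSelfAdjoint H → (E : ℂ) ∉ spectrum ℂ H → (∀ t ∈ spectrum ℝ H, g ≤ |t - E|) →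
      ‖H‖ ≤ M → ‖spectralProj H E - Polynomial.aeval H q‖ ≤ δ := fun H hs hi hgap hM => by
    rw [← cfc_polynomial q H, spectralProj,
      ← cfc_sub _ _ H (continuousOn_indicator_spectrum hi) q.continuous.continuousOn]
    refine norm_cfc_le hδ.le fun t ht => ?_
    have htM : |t| ≤ M := (IsometricContinuousFunctionalCalculus.norm_spectrum_le H ht).trans hM
    have hφ : (Set.Iio E).indicator (fun _ => (1 : ℝ)) t = max 0 (min 1 ((E - t) / g)) := by
      have hgt := hgap t ht
      by_cases h : t < E
      · rw [Set.indicator_of_mem (show t ∈ Set.Iio E from h)]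
        rw [abs_of_neg (by linarith)] at hgt
        rw [min_eq_left ((le_div_iff₀ hg).2 (by linarith)), max_eq_right zero_le_one]
      · rw [Set.indicator_of_notMem (show t ∉ Set.Iio E from h)]
        have : (E - t) / g ≤ 0 := div_nonpos_of_nonpos_of_nonneg (by linarith) hg.le
        exact (max_eq_left ((min_le_right _ _).trans this)).symm
    rw [hφ, Real.norm_eq_abs, abs_sub_comm]
    exact (hq t (abs_le.1 htM)).le
  exact ⟨q, key H₁ s₁ h₁ (fun t ht => (min_le_left _ _).trans (hgap₁ t ht)) (le_max_left _ _),
    key H₂ s₂ h₂ (fun t ht => (min_le_right _ _).trans (hgap₂ t ht)) (le_max_right _ _)⟩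

variable {d : ℕ}

theorem exists_polynomial_near_fermiProj {H₁ H₂ : Op d} {E : ℝ} (s₁ : IsSelfAdjoint H₁)
    (s₂ : IsSelfAdjoint H₂) (h₁ : IsInsulating H₁ E) (h₂ : IsInsulating H₂ E) {δ : ℝ}
    (hδ : 0 < δ) : ∃ q : Polynomial ℝ, ‖fermiProj H₁ E - Polynomial.aeval H₁ q‖ ≤ δ ∧
      ‖fermiProj H₂ E - Polynomial.aeval H₂ q‖ ≤ δ :=
  exists_polynomial_near_spectralProj s₁ s₂ h₁ h₂ hδ

theorem locality_aeval {H₁ H₂ : Op d} (h₁ : IsQuasiLocal H₁) (h₂ : IsQuasiLocal H₂)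
    (q : Polynomial ℝ) : IsQuasiLocal (Polynomial.aeval H₁ q) ∧
      IsQuasiLocal (Polynomial.aeval H₂ q) ∧
      AgreeLocally H₁ H₂ (Polynomial.aeval H₁ q) (Polynomial.aeval H₂ q) := by
  induction q using Polynomial.induction_on with
  | C a =>
    simp only [Polynomial.aeval_C, Algebra.algebraMap_eq_smul_one]
    exact ⟨isQuasiLocal_smul_one a, isQuasiLocal_smul_one a, agreeLocally_self _⟩
  | add p q hp hq =>
    simp only [map_add]
    exact ⟨hp.1.add hq.1, hp.2.1.add hq.2.1, hp.2.2.add hq.2.2⟩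
  | monomial n a h =>
    rw [pow_succ, ← mul_assoc, map_mul, map_mul _ _ Polynomial.X, Polynomial.aeval_X,
      Polynomial.aeval_X]
    exact ⟨h.1.mul h₁, h.2.1.mul h₂, h.2.2.mul (agreeLocally_of_isQuasiLocal h₁ h₂) h.2.1⟩

variable {Θ : L2 d →ₗ⋆[ℂ] L2 d} {H₁ H₂ H : Op d} {E : ℝ}

theorem IsInsulator.isQuasiLocal_fermiProj (h : IsInsulator Θ E H) :
    IsQuasiLocal (fermiProj H E) :=
  isQuasiLocal_of_approx fun δ hδ => by
    obtain ⟨q, hq, -⟩ := exists_polynomial_near_fermiProj h.selfAdjoint h.selfAdjoint h.insulating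
      h.insulating hδ
    exact ⟨_, (locality_aeval h.isLocal.isQuasiLocal h.isLocal.isQuasiLocal q).1, hq⟩

theorem IsInsulator.agreeLocally_fermiProj (h₁ : IsInsulator Θ E H₁) (h₂ : IsInsulator Θ E H₂) :
    AgreeLocally H₁ H₂ (fermiProj H₁ E) (fermiProj H₂ E) :=
  agreeLocally_of_approx fun δ hδ => by
    obtain ⟨q, hq⟩ := exists_polynomial_near_fermiProj h₁.selfAdjoint h₂.selfAdjoint h₁.insulating
      h₂.insulating hδ
    exact ⟨_, _, (locality_aeval h₁.isLocal.isQuasiLocal h₂.isLocal.isQuasiLocal q).2.2, hq⟩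

theorem IsTimeReversal.norm_map (hΘ : IsTimeReversal Θ) (u : L2 d) : ‖Θ u‖ = ‖u‖ := by
  have h := hΘ.inner_map u u
  rw [inner_self_eq_norm_sq_to_K, inner_self_eq_norm_sq_to_K, map_pow, RCLike.conj_ofReal] at h
  have h' : ‖Θ u‖ ^ 2 = ‖u‖ ^ 2 := by exact_mod_cast h
  exact (pow_left_inj₀ (norm_nonneg _) (norm_nonneg _) two_ne_zero).1 h'

theorem isInvariant_aeval (h : IsInvariant Θ H) (q : Polynomial ℝ) :
    IsInvariant Θ (Polynomial.aeval H q) := by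
  induction q using Polynomial.induction_on with
  | C a =>
    intro ψ
    simp only [Polynomial.aeval_C, Algebra.algebraMap_eq_smul_one]
    change (a : ℂ) • Θ ψ = Θ ((a : ℂ) • ψ)
    rw [Θ.map_smulₛₗ, Complex.conj_ofReal]
  | add p q hp hq =>
    intro ψ
    simp only [map_add, add_apply, hp ψ, hq ψ]
  | monomial n a hn =>
    intro ψ
    rw [pow_succ, ← mul_assoc, map_mul, Polynomial.aeval_X, mul_apply_eq_comp,
      mul_apply_eq_comp, h, hn]

/-- The approximating polynomials have real coefficients, so they commute with the antilinear `Θ`;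
the isometry of `Θ` carries this to the limit. -/
theorem IsInsulator.isInvariant_fermiProj (hΘ : IsTimeReversal Θ) (h : IsInsulator Θ E H) :
    IsInvariant Θ (fermiProj H E) := by
  intro ψ
  rw [← sub_eq_zero, ← norm_le_zero_iff]
  refine le_of_forall_pos_le_add fun δ hδ => ?_
  rw [zero_add]
  have hδ' : 0 < δ / (2 * ‖ψ‖ + 1) := by positivity
  obtain ⟨q, hq, -⟩ := exists_polynomial_near_fermiProj h.selfAdjoint h.selfAdjoint h.insulating
    h.insulating hδ'
  set t := δ / (2 * ‖ψ‖ + 1) with ht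
  have ht' : t * (2 * ‖ψ‖ + 1) = δ := div_mul_cancel₀ _ (by positivity)
  have e : fermiProj H E (Θ ψ) - Θ (fermiProj H E ψ) =
      (fermiProj H E - Polynomial.aeval H q) (Θ ψ) -
        Θ ((fermiProj H E - Polynomial.aeval H q) ψ) := by
    rw [sub_apply, sub_apply, map_sub,
      isInvariant_aeval h.invariant q ψ]
    abel
  have e1 := (fermiProj H E - Polynomial.aeval H q).le_of_opNorm_le hq (Θ ψ)
  have e2 := (fermiProj H E - Polynomial.aeval H q).le_of_opNorm_le hq ψ
  rw [e]
  refine (norm_sub_le _ _).trans ?_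
  rw [hΘ.norm_map] at e1 ⊢
  linarith

end FermiProjection

/-! ### Time reversal and the skew pairing -/

section TimeReversal

variable {d : ℕ} {Θ : L2 d →ₗ⋆[ℂ] L2 d}

theorem IsTimeReversal.continuous (hΘ : IsTimeReversal Θ) : Continuous Θ :=
  (AddMonoidHomClass.isometry_of_norm Θ hΘ.norm_map).continuous

/-- Vectors supported at `y` are joint eigenvectors of the positions with real eigenvalues, hence so
are their images; some coordinate separates `x` from `y`. -/
theorem IsTimeReversal.map_single_apply (hΘ : IsTimeReversal Θ) {x y : Lattice} (hxy : x ≠ y)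
    (v : Fibre d) : Θ (lp.single 2 y v) x = 0 := by
  have key : ∀ q : Lattice → ℝ, CommutesWithMul Θ q → q x ≠ q y → Θ (lp.single 2 y v) x = 0 := by
    intro q hq hne
    have h := hq (lp.single 2 y v) ((q y : ℂ) • lp.single 2 y v) (fun z => by
      rw [lp.coeFn_smul, Pi.smul_apply]
      rcases eq_or_ne z y with rfl | hz
      · rfl
      · rw [lp.single_apply_ne _ _ _ hz, smul_zero, smul_zero]) x
    rw [Θ.map_smulₛₗ, Complex.conj_ofReal, lp.coeFn_smul, Pi.smul_apply, ← sub_eq_zero,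
      ← sub_smul] at h
    refine (smul_eq_zero.1 h).resolve_left fun h0 => hne ?_
    exact_mod_cast (sub_eq_zero.1 h0).symm
  by_cases h1 : x.1 = y.1
  · refine key _ hΘ.comm_pos₂ fun h => hxy (Prod.ext h1 ?_)
    exact_mod_cast h
  · refine key _ hΘ.comm_pos₁ fun h => h1 ?_
    exact_mod_cast h

theorem IsTimeReversal.map_apply_eq_zero (hΘ : IsTimeReversal Θ) {φ : L2 d} {x : Lattice}
    (h : φ x = 0) : Θ φ x = 0 := by
  have hs := (lp.hasSum_single (p := 2) (by norm_num) φ).map Θ hΘ.continuous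
  have hs' := hs.mapL (lp.evalCLM ℂ (fun _ : Lattice => Fibre d) 2 x)
  refine hs'.unique ?_
  convert hasSum_zero using 2 with y
  change Θ (lp.single 2 y (φ y)) x = 0
  rcases eq_or_ne x y with rfl | hxy
  · rw [h, lp.single_zero, map_zero]
    rfl
  · exact hΘ.map_single_apply hxy _

/-- `Θ` acts sitewise, and `f ψ - f(x) ψ` vanishes at `x`; antilinearity conjugates the scalar
`f(x)`. -/
theorem IsTimeReversal.map_mulOp (hΘ : IsTimeReversal Θ) {f g : Lattice → ℂ}
    (hf : ∀ x, ‖f x‖ ≤ 1) (hg : ∀ x, ‖g x‖ ≤ 1) (hfg : ∀ x, g x = conj (f x)) (ψ : L2 d) :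
    Θ (mulOp d f hf ψ) = mulOp d g hg (Θ ψ) := by
  refine lp.ext (funext fun x => ?_)
  have h := hΘ.map_apply_eq_zero (φ := mulOp d f hf ψ - f x • ψ) (x := x) (sub_self _)
  rw [map_sub, Θ.map_smulₛₗ] at h
  rw [mulOp_apply, hfg]
  exact sub_eq_zero.1 h

theorem inner_mulOp (f g : Lattice → ℂ) (hf : ∀ x, ‖f x‖ ≤ 1) (hg : ∀ x, ‖g x‖ ≤ 1)
    (hfg : ∀ x, g x = conj (f x)) (φ ψ : L2 d) :
    ⟪mulOp d g hg φ, ψ⟫_ℂ = ⟪φ, mulOp d f hf ψ⟫_ℂ := by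
  rw [lp.inner_eq_tsum, lp.inner_eq_tsum]
  refine tsum_congr fun x => ?_
  rw [mulOp_apply, mulOp_apply, inner_smul_left, inner_smul_right, hfg, Complex.conj_conj]

/-- The source of skewness: the minus sign is that of `Θ² = -1`. For `A = B` and `u = v` the form
vanishes on the diagonal. -/
theorem IsTimeReversal.inner_map_eq_neg (hΘ : IsTimeReversal Θ) {A A' B : Op d}
    (hB : ∀ u, Θ (B u) = A' (Θ u)) (hA : ∀ x y, ⟪A' x, y⟫_ℂ = ⟪x, A y⟫_ℂ) (u v : L2 d) :
    ⟪Θ v, B u⟫_ℂ = -⟪Θ u, A v⟫_ℂ := by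
  have h := hΘ.inner_map (Θ v) (B u)
  rw [hΘ.sq_eq_neg, hB, inner_neg_left] at h
  rw [← hA, ← inner_conj_symm (A' (Θ u)), ← map_neg, h, Complex.conj_conj]

variable {P Q : Op d} {f g c : Lattice → ℂ} {hf : ∀ x, ‖f x‖ ≤ 1} {hg : ∀ x, ‖g x‖ ≤ 1}
  {hc : ∀ x, ‖c x‖ ≤ 1}

theorem map_projected (hΘ : IsTimeReversal Θ) (hfg : ∀ x, g x = conj (f x))
    (hP : IsInvariant Θ P) (u : L2 d) :
    Θ ((P * mulOp d f hf * P + (1 - P)) u) = (P * mulOp d g hg * P + (1 - P)) (Θ u) := by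
  change Θ (P (mulOp d f hf (P u)) + (u - P u)) = P (mulOp d g hg (P (Θ u))) + (Θ u - P (Θ u))
  rw [map_add, map_sub, ← hP, ← hP, hΘ.map_mulOp hf hg hfg, hP]

theorem inner_projected (hfg : ∀ x, g x = conj (f x)) (hP : IsSelfAdjoint P) (x y : L2 d) :
    ⟪(P * mulOp d g hg * P + (1 - P)) x, y⟫_ℂ = ⟪x, (P * mulOp d f hf * P + (1 - P)) y⟫_ℂ := by
  have hs : ∀ u v : L2 d, ⟪P u, v⟫_ℂ = ⟪u, P v⟫_ℂ := hP.isSymmetric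
  change ⟪P (mulOp d g hg (P x)) + (x - P x), y⟫_ℂ = ⟪x, P (mulOp d f hf (P y)) + (y - P y)⟫_ℂ
  rw [inner_add_left, inner_add_right, inner_sub_left, inner_sub_right, hs, hs,
    inner_mulOp f g hf hg hfg, hs]

/-- The bilinear pairing on `ℓ² × ℓ²` for which coupled flux operators are skew. -/
def skewPairing (Θ : L2 d →ₗ⋆[ℂ] L2 d) : L2 d × L2 d →ₗ[ℂ] L2 d × L2 d →ₗ[ℂ] ℂ :=
  LinearMap.mk₂ ℂ (fun p q => ⟪Θ p.1, q.1⟫_ℂ - ⟪Θ p.2, q.2⟫_ℂ)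
    (fun p p' q => by simp only [Prod.fst_add, Prod.snd_add, map_add, inner_add_left]; ring)
    (fun a p q => by
      simp only [Prod.smul_fst, Prod.smul_snd, Θ.map_smulₛₗ, inner_smul_left, Complex.conj_conj,
        smul_eq_mul]
      ring)
    (fun p q q' => by simp only [Prod.fst_add, Prod.snd_add, inner_add_right]; ring)
    (fun a p q => by
      simp only [Prod.smul_fst, Prod.smul_snd, inner_smul_right, smul_eq_mul]
      ring)

theorem skewPairing_apply (p q : L2 d × L2 d) :
    skewPairing Θ p q = ⟪Θ p.1, q.1⟫_ℂ - ⟪Θ p.2, q.2⟫_ℂ := rfl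

theorem skewPairing_nondegenerate (hΘ : IsTimeReversal Θ) (q : L2 d × L2 d)
    (h : ∀ p, skewPairing Θ p q = 0) : q = 0 := by
  have h1 := h (-Θ q.1, 0)
  have h2 := h (0, -Θ q.2)
  rw [skewPairing_apply] at h1 h2
  simp only [map_neg, hΘ.sq_eq_neg, neg_neg, map_zero, inner_zero_left, sub_zero, zero_sub,
    neg_eq_zero, inner_self_eq_zero] at h1 h2
  exact Prod.ext h1 h2

/-- Each diagonal block is skew on its own. The minus sign in the pairing compensates the one in
`-(Q χ P)`, so that the two coupling terms cancel. -/
theorem skewPairing_coupledFlux (hΘ : IsTimeReversal Θ) (hfg : ∀ x, g x = conj (f x))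
    (hcc : ∀ x, c x = conj (c x)) (hPΘ : IsInvariant Θ P) (hQΘ : IsInvariant Θ Q)
    (hP : IsSelfAdjoint P) (hQ : IsSelfAdjoint Q) (p : L2 d × L2 d) :
    skewPairing Θ p (coupledFlux P Q (mulOp d f hf) (mulOp d g hg) (mulOp d c hc) p) = 0 := by
  have hgf : ∀ x, f x = conj (g x) := fun x => by rw [hfg, Complex.conj_conj]
  have diag : ∀ {z : ℂ}, z = -z → z = 0 := fun {z} h => by linear_combination h / 2
  have e1 := diag (hΘ.inner_map_eq_neg (map_projected (hf := hf) (hg := hg) hΘ hfg hPΘ)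
    (inner_projected (hf := hf) (hg := hg) hfg hP) p.1 p.1)
  have e2 := diag (hΘ.inner_map_eq_neg (map_projected (hf := hg) (hg := hf) hΘ hgf hQΘ)
    (inner_projected (hf := hg) (hg := hf) hgf hQ) p.2 p.2)
  have hPs : ∀ u v : L2 d, ⟪P u, v⟫_ℂ = ⟪u, P v⟫_ℂ := hP.isSymmetric
  have hQs : ∀ u v : L2 d, ⟪Q u, v⟫_ℂ = ⟪u, Q v⟫_ℂ := hQ.isSymmetric
  have e3 := hΘ.inner_map_eq_neg (A := P * mulOp d c hc * Q) (A' := Q * mulOp d c hc * P)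
    (B := Q * mulOp d c hc * P)
    (fun u => by
      change Θ (Q (mulOp d c hc (P u))) = Q (mulOp d c hc (P (Θ u)))
      rw [← hQΘ, hΘ.map_mulOp hc hc hcc, hPΘ])
    (fun x y => by
      change ⟪Q (mulOp d c hc (P x)), y⟫_ℂ = ⟪x, P (mulOp d c hc (Q y))⟫_ℂ
      rw [hQs, inner_mulOp c c hc hc hcc, hPs]) p.1 p.2
  rw [skewPairing_apply, coupledFlux, blockOp_apply, inner_add_right, inner_add_right, e1, e2,
    neg_apply, inner_neg_right, e3]
  ring

end TimeReversal

/-! ### Finite-rank perturbations -/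

section FiniteRank

variable {d : ℕ}

/-- An operator whose values are supported in a fixed finite set has finite rank. -/
theorem fg_range_of_support (A : Op d) (F : Finset Lattice) (hA : ∀ ψ, ∀ x ∉ F, A ψ x = 0) :
    (LinearMap.range (A : L2 d →ₗ[ℂ] L2 d)).FG := by
  let Φ : (F → Fibre d) →ₗ[ℂ] L2 d :=
    ∑ y : F, (lp.lsingle (𝕜 := ℂ) (E := fun _ : Lattice => Fibre d) 2 (y : Lattice)) ∘ₗ
      LinearMap.proj y
  have hle : LinearMap.range (A : L2 d →ₗ[ℂ] L2 d) ≤ LinearMap.range Φ := by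
    rintro _ ⟨ψ, rfl⟩
    refine ⟨fun y => A ψ y, ?_⟩
    refine lp.ext (funext fun x => ?_)
    have h1 : Φ (fun y => A ψ y) = ∑ y : F, lp.single 2 (y : Lattice) (A ψ y) := by
      simp only [Φ, LinearMap.sum_apply]
      rfl
    rw [h1, lp.coeFn_sum, Finset.sum_apply]
    simp only [lp.coeFn_single]
    by_cases hx : x ∈ F
    · rw [Finset.sum_eq_single ⟨x, hx⟩]
      · simp
      · intro y _ hy
        exact Pi.single_eq_of_ne (fun h => hy (Subtype.ext h.symm)) _
      · simp
    · refine (Finset.sum_eq_zero fun (y : F) _ => ?_).trans (hA ψ x hx).symm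
      have hxy : x ≠ (y : Lattice) := fun h => hx (h ▸ y.2)
      exact Pi.single_eq_of_ne hxy _
  have : FiniteDimensional ℂ (LinearMap.range Φ) := inferInstance
  have := Submodule.finiteDimensional_of_le hle
  exact Submodule.fg_iff_finiteDimensional _ |>.2 this

theorem fg_range_mul_mul {A : Op d} (h : (LinearMap.range (A : L2 d →ₗ[ℂ] L2 d)).FG)
    (B C : Op d) : (LinearMap.range ((B * A * C : Op d) : L2 d →ₗ[ℂ] L2 d)).FG := by
  have h' := h.map (B : L2 d →ₗ[ℂ] L2 d)
  rw [Submodule.fg_iff_finiteDimensional] at h' ⊢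
  refine Submodule.finiteDimensional_of_le (S₂ := (LinearMap.range (A : L2 d →ₗ[ℂ] L2 d)).map
    (B : L2 d →ₗ[ℂ] L2 d)) ?_
  rintro _ ⟨ψ, rfl⟩
  exact ⟨A (C ψ), ⟨C ψ, rfl⟩, rfl⟩

theorem finiteDimensional_range_blockOp {A B C D : Op d}
    (hA : (LinearMap.range (A : L2 d →ₗ[ℂ] L2 d)).FG)
    (hB : (LinearMap.range (B : L2 d →ₗ[ℂ] L2 d)).FG)
    (hC : (LinearMap.range (C : L2 d →ₗ[ℂ] L2 d)).FG)
    (hD : (LinearMap.range (D : L2 d →ₗ[ℂ] L2 d)).FG) :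
    FiniteDimensional ℂ
      (LinearMap.range (blockOp A B C D : L2 d × L2 d →ₗ[ℂ] L2 d × L2 d)) := by
  have h := (hA.sup hB).prod (hC.sup hD)
  rw [Submodule.fg_iff_finiteDimensional] at h
  refine Submodule.finiteDimensional_of_le (S₂ := (LinearMap.range (A : L2 d →ₗ[ℂ] L2 d) ⊔
    LinearMap.range (B : L2 d →ₗ[ℂ] L2 d)).prod (LinearMap.range (C : L2 d →ₗ[ℂ] L2 d) ⊔
    LinearMap.range (D : L2 d →ₗ[ℂ] L2 d))) ?_
  rintro _ ⟨p, rfl⟩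
  exact ⟨Submodule.add_mem_sup ⟨p.1, rfl⟩ ⟨p.2, rfl⟩,
    Submodule.add_mem_sup ⟨p.1, rfl⟩ ⟨p.2, rfl⟩⟩

/-- Coupled flux operators whose fluxes and couplings agree off a finite set differ by an operator of
finite rank. -/
theorem finiteDimensional_range_coupledFlux_sub (P Q : Op d) {l m c l' m' c' : Op d}
    (F : Finset Lattice) (hl : ∀ ψ, ∀ x ∉ F, (l - l') ψ x = 0)
    (hm : ∀ ψ, ∀ x ∉ F, (m - m') ψ x = 0) (hc : ∀ ψ, ∀ x ∉ F, (c - c') ψ x = 0) :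
    FiniteDimensional ℂ (LinearMap.range ((coupledFlux P Q l m c : L2 d × L2 d →ₗ[ℂ] L2 d × L2 d) -
      (coupledFlux P Q l' m' c' : L2 d × L2 d →ₗ[ℂ] L2 d × L2 d))) := by
  have e : coupledFlux P Q l m c - coupledFlux P Q l' m' c' =
      blockOp (P * (l - l') * P) (P * (c - c') * Q) ((-Q) * (c - c') * P) (Q * (m - m') * Q) := by
    have h1 : P * (l - l') * P = (P * l * P + (1 - P)) - (P * l' * P + (1 - P)) := by
      noncomm_ring
    have h2 : P * (c - c') * Q = P * c * Q - P * c' * Q := by noncomm_ring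
    have h3 : (-Q) * (c - c') * P = -(Q * c * P) - -(Q * c' * P) := by noncomm_ring
    have h4 : Q * (m - m') * Q = (Q * m * Q + (1 - Q)) - (Q * m' * Q + (1 - Q)) := by
      noncomm_ring
    rw [h1, h2, h3, h4]
    refine ContinuousLinearMap.ext fun p => ?_
    simp only [coupledFlux, blockOp_apply, sub_apply, Prod.mk_sub_mk]
    refine Prod.ext ?_ ?_ <;> dsimp only <;> abel
  have h := finiteDimensional_range_blockOp
    (fg_range_mul_mul (fg_range_of_support _ F hl) P P)
    (fg_range_mul_mul (fg_range_of_support _ F hc) P Q)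
    (fg_range_mul_mul (fg_range_of_support _ F hc) (-Q) P)
    (fg_range_mul_mul (fg_range_of_support _ F hm) Q Q)
  rw [← e] at h
  exact h

end FiniteRank

/-! ### The regularized vortex and its bump -/

section Profiles

/-- The length of `(r, x - a) ∈ ℝ × ℝ²`: a regularized distance to `a`. -/
def regDist (a : Lattice) (r : ℝ) (x : Lattice) : ℝ :=
  Real.sqrt (r ^ 2 + eDist x a ^ 2)

/-- A slowly varying regularization of the phase of `x - a`. -/
def regPhase (a : Lattice) (r : ℝ) (x : Lattice) : ℂ :=
  (toComplex x - toComplex a) / (regDist a r x : ℂ)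

/-- The slowly varying function complementary to `regPhase`: the sum of the squared moduli is `1`. -/
def regBump (a : Lattice) (r : ℝ) (x : Lattice) : ℝ := r / regDist a r x

variable {a : Lattice} {r : ℝ}

theorem eDist_nonneg (x y : Lattice) : 0 ≤ eDist x y := norm_nonneg _

theorem regDist_sq (x : Lattice) : regDist a r x ^ 2 = r ^ 2 + eDist x a ^ 2 :=
  Real.sq_sqrt (by positivity)

theorem le_regDist (x : Lattice) : r ≤ regDist a r x :=
  Real.le_sqrt_of_sq_le (by nlinarith [sq_nonneg (eDist x a)])

theorem eDist_le_regDist (x : Lattice) : eDist x a ≤ regDist a r x :=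
  Real.le_sqrt_of_sq_le (by nlinarith [sq_nonneg r])

theorem regDist_le (hr : 0 < r) (x : Lattice) : regDist a r x ≤ r + eDist x a :=
  Real.sqrt_le_iff.2 ⟨by have := eDist_nonneg x a; positivity,
    by nlinarith [mul_nonneg hr.le (eDist_nonneg x a)]⟩

theorem regDist_pos (hr : 0 < r) (x : Lattice) : 0 < regDist a r x := hr.trans_le (le_regDist x)

theorem abs_regDist_sub_le (hr : 0 < r) (x y : Lattice) :
    |regDist a r x - regDist a r y| ≤ eDist x y := by
  have hx := regDist_pos (a := a) hr x
  have hy := regDist_pos (a := a) hr y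
  have h1 : |regDist a r x - regDist a r y| * (regDist a r x + regDist a r y) =
      |eDist x a - eDist y a| * (eDist x a + eDist y a) := by
    rw [← abs_of_pos (add_pos hx hy), ← abs_mul,
      ← abs_of_nonneg (add_nonneg (eDist_nonneg x a) (eDist_nonneg y a)), ← abs_mul]
    congr 1
    linear_combination regDist_sq (a := a) (r := r) x - regDist_sq (a := a) (r := r) y
  have h2 : |eDist x a - eDist y a| * (eDist x a + eDist y a) ≤
      eDist x y * (regDist a r x + regDist a r y) :=
    mul_le_mul (abs_eDist_sub_le x y a) (add_le_add (eDist_le_regDist x) (eDist_le_regDist y))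
      (add_nonneg (eDist_nonneg x a) (eDist_nonneg y a)) (eDist_nonneg x y)
  exact le_of_mul_le_mul_right (h1 ▸ h2) (add_pos hx hy)

theorem norm_regPhase (hr : 0 < r) (x : Lattice) : ‖regPhase a r x‖ = eDist x a / regDist a r x := by
  rw [regPhase, norm_div, Complex.norm_real, Real.norm_of_nonneg (regDist_pos hr x).le]
  rfl

theorem norm_regPhase_le (hr : 0 < r) (x : Lattice) : ‖regPhase a r x‖ ≤ 1 := by
  rw [norm_regPhase hr]
  exact (div_le_one (regDist_pos hr x)).2 (eDist_le_regDist x)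

theorem regBump_nonneg (hr : 0 < r) (x : Lattice) : 0 ≤ regBump a r x :=
  (div_pos hr (regDist_pos hr x)).le

theorem regBump_le (hr : 0 < r) (x : Lattice) : regBump a r x ≤ 1 :=
  (div_le_one (regDist_pos hr x)).2 (le_regDist x)

theorem conj_regPhase_mul_add (hr : 0 < r) (x : Lattice) :
    conj (regPhase a r x) * regPhase a r x + (regBump a r x : ℂ) * (regBump a r x : ℂ) = 1 := by
  rw [mul_comm, Complex.mul_conj, Complex.normSq_eq_norm_sq, norm_regPhase hr, regBump]
  norm_cast
  have := (regDist_pos (a := a) hr x).ne'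
  field_simp
  linarith [regDist_sq (a := a) (r := r) x]

theorem norm_regPhase_sub_le (hr : 0 < r) (x y : Lattice) :
    ‖regPhase a r x - regPhase a r y‖ ≤ 2 / r * eDist x y := by
  have hx := regDist_pos (a := a) hr x
  have hy := regDist_pos (a := a) hr y
  have hx' : (regDist a r x : ℂ) ≠ 0 := by exact_mod_cast hx.ne'
  have hy' : (regDist a r y : ℂ) ≠ 0 := by exact_mod_cast hy.ne'
  have e : regPhase a r x - regPhase a r y = (toComplex x - toComplex y) / (regDist a r x : ℂ) +
      regPhase a r y * (((regDist a r y - regDist a r x : ℝ) : ℂ) / (regDist a r x : ℂ)) := by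
    rw [regPhase, regPhase]
    push_cast
    field_simp
    ring
  have h1 : ‖(toComplex x - toComplex y) / (regDist a r x : ℂ)‖ ≤ eDist x y / r := by
    rw [norm_div, Complex.norm_real, Real.norm_of_nonneg hx.le]
    exact div_le_div_of_nonneg_left (eDist_nonneg x y) hr (le_regDist x)
  have h2 : ‖((regDist a r y - regDist a r x : ℝ) : ℂ) / (regDist a r x : ℂ)‖ ≤ eDist x y / r := by
    rw [norm_div, Complex.norm_real, Complex.norm_real, Real.norm_of_nonneg hx.le, norm_sub_rev]
    exact div_le_div₀ (eDist_nonneg x y) (abs_regDist_sub_le hr x y) hr (le_regDist x)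
  rw [e]
  calc _ ≤ eDist x y / r + 1 * (eDist x y / r) := (norm_add_le _ _).trans (add_le_add h1
        ((norm_mul_le _ _).trans (mul_le_mul (norm_regPhase_le hr y) h2 (norm_nonneg _)
          zero_le_one)))
    _ = _ := by ring

theorem abs_regBump_sub_le (hr : 0 < r) (x y : Lattice) :
    |regBump a r x - regBump a r y| ≤ 2 / r * eDist x y := by
  have hx := regDist_pos (a := a) hr x
  have hy := regDist_pos (a := a) hr y
  have e : regBump a r x - regBump a r y =
      regBump a r y * ((regDist a r y - regDist a r x) / regDist a r x) := by
    rw [regBump, regBump]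
    field_simp
  rw [e, abs_mul, abs_of_nonneg (regBump_nonneg hr y), abs_div, abs_of_pos hx, abs_sub_comm]
  have h := div_le_div₀ (eDist_nonneg x y) (abs_regDist_sub_le (a := a) hr x y) hr
    (le_regDist (a := a) x)
  calc _ ≤ 1 * (eDist x y / r) :=
        mul_le_mul (regBump_le hr y) h (by positivity) zero_le_one
    _ ≤ 2 / r * eDist x y := by
        rw [one_mul, div_mul_eq_mul_div]
        gcongr
        linarith [eDist_nonneg x y]

theorem finite_norm_toComplex_le (T : ℝ) : {x : Lattice | ‖toComplex x‖ ≤ T}.Finite := by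
  obtain ⟨k, hk⟩ := exists_nat_ge T
  refine (Set.finite_Icc ((-k, -k) : Lattice) (k, k)).subset fun x hx => ?_
  have h1 : |(x.1 : ℝ)| ≤ k := ((Complex.abs_re_le_norm (toComplex x)).trans hx).trans hk
  have h2 : |(x.2 : ℝ)| ≤ k := ((Complex.abs_im_le_norm (toComplex x)).trans hx).trans hk
  have h1' : |x.1| ≤ k := by exact_mod_cast h1
  have h2' : |x.2| ≤ k := by exact_mod_cast h2
  rw [abs_le] at h1' h2'
  exact ⟨⟨h1'.1, h2'.1⟩, ⟨h1'.2, h2'.2⟩⟩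

theorem laughlinPhase_mul_norm (x : Lattice) :
    laughlinPhase x * (‖toComplex x‖ : ℂ) = toComplex x := by
  rw [mul_comm, laughlinPhase, Complex.norm_mul_exp_arg_mul_I]

/-- At infinity, `regPhase` approaches the phase and `regBump` vanishes. -/
theorem exists_finset_regPhase_near (a : Lattice) (hr : 0 < r) {δ : ℝ} (hδ : 0 < δ) :
    ∃ F : Finset Lattice, ∀ x ∉ F, ‖laughlinPhase x - regPhase a r x‖ ≤ δ ∧ regBump a r x ≤ δ := by
  set b := ‖toComplex a‖ with hb
  have hb0 : 0 ≤ b := norm_nonneg _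
  -- The phase error times `|x|` is at most `r + 2 |a|`; the extra `b` ensures `|x - a| ≥ (r + 2 b)
  -- / δ`, as the bump requires.
  refine ⟨(finite_norm_toComplex_le ((r + 2 * b) / δ + b)).toFinset, fun x hx => ?_⟩
  rw [Set.Finite.mem_toFinset, Set.mem_ofPred_eq, not_le] at hx
  set t := ‖toComplex x‖ with ht
  have ht0 : 0 < t := lt_of_le_of_lt (by positivity) hx
  have htδ : r + 2 * b ≤ δ * t := by
    have : (r + 2 * b) / δ ≤ t := by linarith
    rw [div_le_iff₀ hδ] at this
    linarith
  have hN := regDist_pos (a := a) hr x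
  have htb : eDist x a ≤ t + b := norm_sub_le _ _
  have htb' : t - b ≤ eDist x a := norm_sub_norm_le _ _
  have hN1 : |t - regDist a r x| ≤ r + b := by
    have h1 := regDist_le (a := a) hr x
    have h2 := eDist_le_regDist (a := a) (r := r) x
    rw [abs_le]
    constructor <;> linarith
  constructor
  · have e : (t : ℂ) * (laughlinPhase x - regPhase a r x) =
        toComplex a + regPhase a r x * ((regDist a r x - t : ℝ) : ℂ) := by
      have hN' : (regDist a r x : ℂ) ≠ 0 := by exact_mod_cast hN.ne'
      have e1 : regPhase a r x * (regDist a r x : ℂ) = toComplex x - toComplex a :=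
        div_mul_cancel₀ _ hN'
      push_cast
      linear_combination laughlinPhase_mul_norm x - e1
    have h : t * ‖laughlinPhase x - regPhase a r x‖ ≤ b + 1 * (r + b) := by
      have h1 := congrArg norm e
      rw [norm_mul, Complex.norm_real, Real.norm_of_nonneg ht0.le] at h1
      rw [h1]
      refine (norm_add_le _ _).trans (add_le_add le_rfl ((norm_mul_le _ _).trans
        (mul_le_mul (norm_regPhase_le hr x) ?_ (norm_nonneg _) zero_le_one)))
      rwa [Complex.norm_real, norm_sub_rev]
    exact le_of_mul_le_mul_left (by linarith) ht0
  · rw [regBump, div_le_iff₀ hN]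
    have h2 := eDist_le_regDist (a := a) (r := r) x
    have h3 : (r + 2 * b) / δ ≤ regDist a r x := by linarith
    rw [div_le_iff₀ hδ] at h3
    linarith

end Profiles

/-! ### Opposite fluxes -/

section Index

variable {d : ℕ} {Θ : L2 d →ₗ⋆[ℂ] L2 d} {E : ℝ} {H H₁ H₂ : Op d}

theorem conj_laughlinPhase_mul (x : Lattice) : conj (laughlinPhase x) * laughlinPhase x = 1 := by
  rw [mul_comm, Complex.mul_conj, Complex.normSq_eq_norm_sq, laughlinPhase,
    Complex.norm_exp_ofReal_mul_I]
  norm_num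

theorem norm_commutator_mulOp_le {P : Op d} (hP : ‖P‖ ≤ 1) {f g : Lattice → ℂ}
    (hf : ∀ x, ‖f x‖ ≤ 1) (hg : ∀ x, ‖g x‖ ≤ 1) {δ : ℝ} (hδ : 0 ≤ δ) (hfg : ∀ x, ‖f x - g x‖ ≤ δ)
    (h : ‖P * mulOp d g hg - mulOp d g hg * P‖ ≤ δ) :
    ‖P * mulOp d f hf - mulOp d f hf * P‖ ≤ 3 * δ := by
  have := norm_commutator_sub_le (norm_mulOp_sub_le (d := d) hf hg hδ hfg) hP
  rw [norm_sub_rev] at h ⊢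
  linarith

/-- The flux operator with the opposite flux. -/
def oppositeFluxOp (H : Op d) (E : ℝ) : Op d :=
  fermiProj H E * mulOp d (fun x => conj (laughlinPhase x))
    (fun x => by rw [RCLike.norm_conj]; exact norm_laughlinPhase_le x) * fermiProj H E +
      (1 - fermiProj H E)

/-- Time reversal identifies the kernels of the flux operator and its opposite. -/
theorem rank_ker_oppositeFluxOp (hΘ : IsTimeReversal Θ) (h : IsInsulator Θ E H) :
    Module.rank ℂ (LinearMap.ker (oppositeFluxOp H E : L2 d →ₗ[ℂ] L2 d)) =
      Module.rank ℂ (fluxKer H E) := by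
  have hP := h.isInvariant_fermiProj hΘ
  have e1 : ∀ u, Θ (oppositeFluxOp H E u) = fluxOp H E (Θ u) :=
    map_projected hΘ (fun x => (Complex.conj_conj _).symm) hP
  have e2 : ∀ u, Θ (fluxOp H E u) = oppositeFluxOp H E (Θ u) :=
    map_projected hΘ (fun x => rfl) hP
  let j : LinearMap.ker (oppositeFluxOp H E : L2 d →ₗ[ℂ] L2 d) ≃+ fluxKer H E :=
    { toFun := fun u => ⟨Θ u, by
        have hu : oppositeFluxOp H E u = 0 := u.2
        change fluxOp H E (Θ u) = 0
        rw [← e1, hu, map_zero]⟩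
      invFun := fun u => ⟨-Θ u, by
        have hu : fluxOp H E u = 0 := u.2
        change oppositeFluxOp H E (-Θ u) = 0
        rw [map_neg, ← e2, hu, map_zero, neg_zero]⟩
      left_inv := fun u => Subtype.ext (by
        change -Θ (Θ u) = u
        rw [hΘ.sq_eq_neg, neg_neg])
      right_inv := fun u => Subtype.ext (by
        change Θ (-Θ u) = u
        rw [map_neg, hΘ.sq_eq_neg, neg_neg])
      map_add' := fun u v => Subtype.ext (map_add Θ _ _) }
  -- A bijection semilinear over conjugation preserves rank. Cardinal rank is used, so finiteness of
  -- either kernel is not needed.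
  exact rank_eq_of_equiv_equiv (starRingEnd ℂ) j (starRingAut (R := ℂ)).bijective
    fun c u => Subtype.ext (Θ.map_smulₛₗ c u)

end Index

/-! ### Parity of the sum of the two kernel dimensions -/

section LocalIndex

variable {d : ℕ} {Θ : L2 d →ₗ⋆[ℂ] L2 d} {E : ℝ} {H₁ H₂ : Op d}

/-- The uncoupled pair of a flux operator and an opposite flux operator. -/
def fluxPair (H₁ H₂ : Op d) (E : ℝ) : L2 d × L2 d →L[ℂ] L2 d × L2 d :=
  coupledFlux (fermiProj H₁ E) (fermiProj H₂ E) (laughlin d)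
    (mulOp d (fun x => conj (laughlinPhase x))
      (fun x => by rw [RCLike.norm_conj]; exact norm_laughlinPhase_le x))
    (mulOp d (fun _ => 0) (fun _ => by simp))

theorem fluxPair_apply (p : L2 d × L2 d) :
    fluxPair H₁ H₂ E p = (fluxOp H₁ E p.1, oppositeFluxOp H₂ E p.2) := by
  have h0 : mulOp d (fun _ => 0) (fun _ => by simp) = 0 := by
    ext ψ x i
    simp [mulOp_apply]
  rw [fluxPair, coupledFlux, h0, blockOp_apply]
  simp only [mul_zero, zero_mul, neg_zero, zero_apply, add_zero, zero_add]
  rfl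

/-- The kernel of `fluxPair` is the product of the two kernels. -/
def kerFluxPairEquiv (H₁ H₂ : Op d) (E : ℝ) :
    LinearMap.ker (fluxPair H₁ H₂ E : L2 d × L2 d →ₗ[ℂ] L2 d × L2 d) ≃ₗ[ℂ]
      fluxKer H₁ E × LinearMap.ker (oppositeFluxOp H₂ E : L2 d →ₗ[ℂ] L2 d) where
  toFun p := (⟨p.1.1, congrArg Prod.fst ((fluxPair_apply p.1).symm.trans p.2)⟩,
    ⟨p.1.2, congrArg Prod.snd ((fluxPair_apply p.1).symm.trans p.2)⟩)
  invFun q := ⟨(q.1, q.2), (fluxPair_apply _).trans (Prod.ext q.1.2 q.2.2)⟩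
  left_inv _ := rfl
  right_inv _ := rfl
  map_add' _ _ := rfl
  map_smul' _ _ := rfl

theorem even_finrank_add_finrank (hΘ : IsTimeReversal Θ) (h₂ : IsInsulator Θ E H₂)
    (hfin : FiniteDimensional ℂ (LinearMap.ker
      (fluxPair H₁ H₂ E : L2 d × L2 d →ₗ[ℂ] L2 d × L2 d)))
    (heven : Even (Module.finrank ℂ (LinearMap.ker
      (fluxPair H₁ H₂ E : L2 d × L2 d →ₗ[ℂ] L2 d × L2 d)))) :
    FiniteDimensional ℂ (fluxKer H₁ E) ∧
      Even (Module.finrank ℂ (fluxKer H₁ E) + Module.finrank ℂ (fluxKer H₂ E)) := by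
  let e := kerFluxPairEquiv H₁ H₂ E
  have f1 : FiniteDimensional ℂ (fluxKer H₁ E) :=
    Module.Finite.of_surjective (LinearMap.fst ℂ _ _ ∘ₗ e.toLinearMap)
      (Prod.fst_surjective.comp e.surjective)
  have f2 : FiniteDimensional ℂ (LinearMap.ker (oppositeFluxOp H₂ E : L2 d →ₗ[ℂ] L2 d)) :=
    Module.Finite.of_surjective (LinearMap.snd ℂ _ _ ∘ₗ e.toLinearMap)
      (Prod.snd_surjective.comp e.surjective)
  refine ⟨f1, ?_⟩
  have h := e.finrank_eq
  have h' : Module.finrank ℂ (LinearMap.ker (oppositeFluxOp H₂ E : L2 d →ₗ[ℂ] L2 d)) =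
      Module.finrank ℂ (fluxKer H₂ E) :=
    congrArg Cardinal.toNat (rank_ker_oppositeFluxOp hΘ h₂)
  rw [Module.finrank_prod, h'] at h
  rwa [← h]

/-- If a coupled flux operator with the flux and coupling `l`, `c`, which are those of `fluxPair` off a
finite set, is bijective, then the kernel of `fluxPair` is even-dimensional. -/
theorem even_finrank_ker_fluxPair (hΘ : IsTimeReversal Θ) (h₁ : IsInsulator Θ E H₁)
    (h₂ : IsInsulator Θ E H₂) {l m c : Lattice → ℂ} (hl : ∀ x, ‖l x‖ ≤ 1) (hm : ∀ x, ‖m x‖ ≤ 1)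
    (hc : ∀ x, ‖c x‖ ≤ 1) (hlm : ∀ x, m x = conj (l x)) (hcc : ∀ x, c x = conj (c x))
    (F : Finset Lattice) (hlF : ∀ x ∉ F, l x = laughlinPhase x) (hcF : ∀ x ∉ F, c x = 0)
    (hS : Function.Bijective (coupledFlux (fermiProj H₁ E) (fermiProj H₂ E) (mulOp d l hl)
      (mulOp d m hm) (mulOp d c hc))) :
    FiniteDimensional ℂ (LinearMap.ker (fluxPair H₁ H₂ E : L2 d × L2 d →ₗ[ℂ] L2 d × L2 d)) ∧
      Even (Module.finrank ℂ (LinearMap.ker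
        (fluxPair H₁ H₂ E : L2 d × L2 d →ₗ[ℂ] L2 d × L2 d))) := by
  have s₁ := isSelfAdjoint_spectralProj H₁ E
  have s₂ := isSelfAdjoint_spectralProj H₂ E
  refine even_finrank_ker_of_finite_rank_sub (skewPairing Θ) (skewPairing_nondegenerate hΘ) _ _ hS
    (skewPairing_coupledFlux hΘ hlm hcc (h₁.isInvariant_fermiProj hΘ)
      (h₂.isInvariant_fermiProj hΘ) s₁ s₂)
    (skewPairing_coupledFlux hΘ (fun _ => rfl) (fun _ => (map_zero _).symm)
      (h₁.isInvariant_fermiProj hΘ) (h₂.isInvariant_fermiProj hΘ) s₁ s₂)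
    (finiteDimensional_range_coupledFlux_sub _ _ F ?_ ?_ ?_)
  · intro ψ x hx
    change laughlinPhase x • ψ x - l x • ψ x = 0
    rw [hlF x hx, sub_self]
  · intro ψ x hx
    change conj (laughlinPhase x) • ψ x - m x • ψ x = 0
    rw [hlm, hlF x hx, sub_self]
  · intro ψ x hx
    change (0 : ℂ) • ψ x - c x • ψ x = 0
    rw [hcF x hx, sub_self]

/-- The length scale `r`, then `ε` and `R`, are fixed before the centre `a`, since the Lipschitz
bounds for the profiles do not depend on it. Only the finite set `F` depends on `a`, and no estimate
involves its size. -/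
theorem exists_scale_even_finrank (hΘ : IsTimeReversal Θ) (h₁ : IsInsulator Θ E H₁)
    (h₂ : IsInsulator Θ E H₂) : ∃ ε R : ℝ, 0 < ε ∧ 0 < R ∧ ∀ a,
      ‖indOp d (eBall a R) * (H₁ - H₂) * indOp d (eBall a R)‖ ≤ ε →
        FiniteDimensional ℂ (fluxKer H₁ E) ∧
          Even (Module.finrank ℂ (fluxKer H₁ E) + Module.finrank ℂ (fluxKer H₂ E)) := by
  classical
  obtain ⟨κ, hκ, hcomm⟩ := h₁.isQuasiLocal_fermiProj.exists_common h₂.isQuasiLocal_fermiProj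
    (show (0 : ℝ) < 1 / 20 by norm_num)
  set r := 2 / κ with hr_def
  have hr : 0 < r := by positivity
  have hrκ : 2 / r = κ := by rw [hr_def]; field_simp
  -- Beyond distance `20 r` from `a` the bump is at most `1 / 20`, so agreement of the projections
  -- matters only inside.
  obtain ⟨ε, R, hε, hR, hagree⟩ :=
    h₁.agreeLocally_fermiProj h₂ (1 / 20) (20 * r) (by norm_num)
  refine ⟨ε, R, hε, hR, fun a ha => ?_⟩
  have hPQ := hagree a ha
  obtain ⟨F, hF⟩ := exists_finset_regPhase_near a hr (show (0 : ℝ) < 1 / 20 by norm_num)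
  have hP1 := norm_spectralProj_le H₁ E
  have hQ1 := norm_spectralProj_le H₂ E
  have hPP := spectralProj_mul_self h₁.insulating
  have hQQ := spectralProj_mul_self h₂.insulating
  change ‖fermiProj H₁ E‖ ≤ 1 at hP1
  change ‖fermiProj H₂ E‖ ≤ 1 at hQ1
  change fermiProj H₁ E * fermiProj H₁ E = fermiProj H₁ E at hPP
  change fermiProj H₂ E * fermiProj H₂ E = fermiProj H₂ E at hQQ
  -- Splicing on `F` gives exact agreement with the uncoupled profiles at infinity, hence a
  -- finite-rank difference. The jumps are harmless: the spliced functions stay within `1 / 20` of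
  -- slowly varying ones.
  let l : Lattice → ℂ := fun x => if x ∈ F then regPhase a r x else laughlinPhase x
  let m : Lattice → ℂ := fun x => conj (l x)
  let c : Lattice → ℂ := fun x => if x ∈ F then (regBump a r x : ℂ) else 0
  have hl : ∀ x, ‖l x‖ ≤ 1 := fun x => by
    by_cases hx : x ∈ F
    · simpa [l, hx] using norm_regPhase_le hr x
    · simpa [l, hx] using norm_laughlinPhase_le x
  have hm : ∀ x, ‖m x‖ ≤ 1 := fun x => by
    rw [RCLike.norm_conj]
    exact hl x
  have hbump : ∀ x, ‖(regBump a r x : ℂ)‖ = regBump a r x := fun x => by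
    rw [Complex.norm_real, Real.norm_of_nonneg (regBump_nonneg hr x)]
  have hcle : ∀ x, ‖c x‖ ≤ regBump a r x := fun x => by
    by_cases hx : x ∈ F
    · simp only [c, hx, if_true]
      exact (hbump x).le
    · simpa [c, hx] using regBump_nonneg hr x
  have hc : ∀ x, ‖c x‖ ≤ 1 := fun x => (hcle x).trans (regBump_le hr x)
  have hnear_l : ∀ x, ‖l x - regPhase a r x‖ ≤ 1 / 20 := fun x => by
    by_cases hx : x ∈ F
    · simp [l, hx]
    · simpa [l, hx] using (hF x hx).1
  have hnear_m : ∀ x, ‖m x - conj (regPhase a r x)‖ ≤ 1 / 20 := fun x => by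
    rw [← map_sub, RCLike.norm_conj]
    exact hnear_l x
  have hnear_c : ∀ x, ‖c x - (regBump a r x : ℂ)‖ ≤ 1 / 20 := fun x => by
    by_cases hx : x ∈ F
    · simp [c, hx]
    · simp only [c, hx, if_false, zero_sub, norm_neg]
      exact (hbump x).le.trans (hF x hx).2
  have c_l := hcomm (regPhase a r) (norm_regPhase_le hr) fun x y => by
    rw [← hrκ]
    exact norm_regPhase_sub_le hr x y
  have c_m := hcomm (fun x => conj (regPhase a r x))
    (fun x => by rw [RCLike.norm_conj]; exact norm_regPhase_le hr x) fun x y => by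
    rw [← hrκ, ← map_sub, RCLike.norm_conj]
    exact norm_regPhase_sub_le hr x y
  have c_c := hcomm (fun x => (regBump a r x : ℂ))
    (fun x => by rw [hbump]; exact regBump_le hr x) fun x y => by
    rw [← hrκ, ← Complex.ofReal_sub, Complex.norm_real]
    exact abs_regBump_sub_le hr x y
  have hsum : ∀ x, m x * l x + c x * c x = 1 := fun x => by
    by_cases hx : x ∈ F
    · simpa [m, l, c, hx] using conj_regPhase_mul_add hr x
    · simpa [m, l, c, hx] using conj_laughlinPhase_mul x
  have hpart : mulOp d m hm * mulOp d l hl + mulOp d c hc * mulOp d c hc = 1 := by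
    ext1 ψ
    refine lp.ext (funext fun x => ?_)
    change m x • l x • ψ x + c x • c x • ψ x = ψ x
    rw [smul_smul, smul_smul, ← add_smul, hsum, one_smul]
  have hχ : ‖mulOp d c hc * (fermiProj H₁ E - fermiProj H₂ E)‖ ≤ 3 * (1 / 20) := by
    set D := fermiProj H₁ E - fermiProj H₂ E
    set J := indOp d (eBall a (20 * r))
    have htail : ‖mulOp d c hc - mulOp d c hc * J‖ ≤ 1 / 20 := by
      let c' : Lattice → ℂ := fun x => c x * (eBall a (20 * r)).indicator (fun _ => (1 : ℂ)) x
      have hc' : ∀ x, ‖c' x‖ ≤ 1 := fun x => by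
        rw [norm_mul]
        exact mul_le_one₀ (hc x) (norm_nonneg _) (norm_indicator_le _ x)
      rw [show mulOp d c hc * J = mulOp d c' hc' from mulOp_mul_mulOp _ _ _ fun _ => rfl]
      refine norm_mulOp_sub_le hc hc' (by norm_num) fun x => ?_
      by_cases hx : x ∈ eBall a (20 * r)
      · simp [c', hx]
      · have hx' : 20 * r ≤ eDist x a := not_lt.1 hx
        simp only [c', hx, not_false_eq_true, Set.indicator_of_notMem, mul_zero, sub_zero]
        refine (hcle x).trans ((div_le_iff₀ (regDist_pos hr x)).2 ?_)
        linarith [eDist_le_regDist (a := a) (r := r) x]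
    have hD : ‖D‖ ≤ 2 := (norm_sub_le _ _).trans (by linarith)
    have e : mulOp d c hc * D =
        mulOp d c hc * (J * D) + (mulOp d c hc - mulOp d c hc * J) * D := by noncomm_ring
    rw [e]
    have e1 : ‖mulOp d c hc * (J * D)‖ ≤ 1 * (1 / 20) :=
      (norm_mul_le _ _).trans (mul_le_mul (norm_mulOp_le_one hc) hPQ (norm_nonneg _) zero_le_one)
    have e2 : ‖(mulOp d c hc - mulOp d c hc * J) * D‖ ≤ 1 / 20 * 2 :=
      (norm_mul_le _ _).trans (mul_le_mul htail hD (norm_nonneg _) (by norm_num))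
    exact (norm_add_le _ _).trans (by linarith)
  have hδ : (0 : ℝ) ≤ 1 / 20 := by norm_num
  -- Each commutator costs `1 / 20` for the smooth profile and `2 / 20` for the splice; `6 * (3 /
  -- 20) < 1`.
  have hS := bijective_coupledFlux (δ := 3 * (1 / 20)) (by norm_num) hPP hQQ hP1 hQ1
    (norm_mulOp_le_one hl) (norm_mulOp_le_one hm) (norm_mulOp_le_one hc) hpart
    (by rw [mulOp_mul_comm hl hm]; exact hpart) (mulOp_mul_comm hl hc) (mulOp_mul_comm hm hc)
    (norm_commutator_mulOp_le hP1 hl _ hδ hnear_l c_l.1)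
    (norm_commutator_mulOp_le hP1 hm _ hδ hnear_m c_m.1)
    (norm_commutator_mulOp_le hP1 hc _ hδ hnear_c c_c.1)
    (norm_commutator_mulOp_le hQ1 hl _ hδ hnear_l c_l.2)
    (norm_commutator_mulOp_le hQ1 hm _ hδ hnear_m c_m.2)
    (norm_commutator_mulOp_le hQ1 hc _ hδ hnear_c c_c.2) hχ
  obtain ⟨hfin, heven⟩ := even_finrank_ker_fluxPair hΘ h₁ h₂ hl hm hc (fun _ => rfl)
    (fun x => by by_cases hx : x ∈ F <;> simp [c, hx]) F (fun x hx => if_neg hx)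
    (fun x hx => if_neg hx) hS
  exact even_finrank_add_finrank hΘ h₂ hfin heven

/-- The kernel of the flux operator of an insulator is finite-dimensional. -/
theorem IsInsulator.finiteDimensional_fluxKer (hΘ : IsTimeReversal Θ) (h : IsInsulator Θ E H₁) :
    FiniteDimensional ℂ (fluxKer H₁ E) := by
  -- With both Hamiltonians equal, the closeness hypothesis is trivial at any centre.
  obtain ⟨ε, R, hε, -, hscale⟩ := exists_scale_even_finrank hΘ h h
  exact (hscale 0 (by simpa using hε.le)).1

end LocalIndex

end Z2Insulator

end

theorem proposition5 (d : ℕ) (Θ : Z2Insulator.L2 d →ₗ⋆[ℂ] Z2Insulator.L2 d)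
    (hΘ : Z2Insulator.IsTimeReversal Θ) (E_F : ℝ) (H₁ H₂ : Z2Insulator.Op d)
    (h₁ : Z2Insulator.IsInsulator Θ E_F H₁) (h₂ : Z2Insulator.IsInsulator Θ E_F H₂) :
    (FiniteDimensional ℂ (Z2Insulator.fluxKer H₁ E_F) ∧
      FiniteDimensional ℂ (Z2Insulator.fluxKer H₂ E_F)) ∧
    ∃ ε R : ℝ, 0 < ε ∧ 0 < R ∧
      ((∃ a : Z2Insulator.Lattice,
          ‖Z2Insulator.indOp d (Z2Insulator.eBall a R) * (H₁ - H₂) *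
            Z2Insulator.indOp d (Z2Insulator.eBall a R)‖ ≤ ε) →
        Z2Insulator.z2Index H₁ E_F = Z2Insulator.z2Index H₂ E_F) := by
  refine ⟨⟨h₁.finiteDimensional_fluxKer hΘ, h₂.finiteDimensional_fluxKer hΘ⟩, ?_⟩
  obtain ⟨ε, R, hε, hR, h⟩ := Z2Insulator.exists_scale_even_finrank hΘ h₁ h₂
  refine ⟨ε, R, hε, hR, fun ⟨a, ha⟩ => ?_⟩
  have hev := (ZMod.natCast_eq_zero_iff_even).2 (h a ha).2
  rw [Nat.cast_add] at hev
  exact CharTwo.add_eq_zero.1 hev
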